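/- Let $n\ge 1$. For a polytope $P$ (the convex hull of finitely many points in a real vector space), its normal fan is the set of the outer normal cones of all nonempty faces of $P$, considered in the dual of the direction space of the affine hull of $P$. Two polytopes are \emph{normally isomorphic} if some linear isomorphism between the spaces of their normal fans carries the cones of one fan onto the cones of the other. "A polytope with normal fan $\mathcal F$", for a fan $\mathcal F$ in an $n$-dimensional vector space $V$, means an $n$-dimensional polytope whose normal fan is $\mathcal F$ after a linear identification of $V$ with the space of its normal fan. \emph{Hohlweg--Lange associahedra.} For $\sigma\in\{+,-\}^{n-1}$ give the vertices $0,1,\dots,n+2$ of a convex $(n+3)$-gon the signs $+,-,\sigma,-,+$ in this order and place them from left to right so that the positive vertices lie on the upper chain and the negative vertices on the lower chain of the polygon. For an internal diagonal $ij$ ($i<j$), let $S_{ij}(\sigma)\subseteq\{1,\dots,n+1\}$ be obtained from the set of vertices strictly below the line $ij$ by replacing $0$ (if present) by $i$ and $n+2$ (if present) by $j$. Then $$\mathrm{Ass}^{\mathrm I}(\sigma)=\Big\{x\in\mathbb R^{n+1}:\ \sum_{k\in S_{ij}(\sigma)}x_k\ \ge\ \tfrac12|S_{ij}(\sigma)|(|S_{ij}(\sigma)|+1)\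 \text{ for all internal diagonals } ij,\quad \sum_{k=1}^{n+1}x_k=\tfrac{(n+1)(n+2)}2\Big\}.$$ \emph{Santos associahedra.} Let $T$ be a triangulation of a convex $(n+3)$-gon with (internal) diagonals $\delta_1,\dots,\delta_n$, and let $\alpha_1,\dots,\alpha_n$ be a basis of an $n$-dimensional real vector space. To each internal diagonal $d$ associate $v_d=-\alpha_i$ if $d=\delta_i$, and $v_d=\sum_{i:\,d\text{ crosses }\delta_i}\alpha_i$ if $d\notin T$. A Santos associahedron $\mathrm{Ass}^{\mathrm{II}}(T)$ is a polytope with normal fan consisting of the cones generated by $\{v_d:d\in D\}$, for all sets $D$ of pairwise non-crossing internal diagonals. \emph{Chapoton--Fomin--Zelevinsky associahedron.} Let $\alpha_i=e_i-e_{i+1}$ ($1\le i\le n$) be the simple roots of type $A_n$ in $\{x\in\mathbb R^{n+1}:\sum x_k=0\}$, and let $\delta_1,\dots,\delta_n$ be the successive diagonals $\{1,n+2\},\{1,n+1\},\{2,n+1\},\{2,n\},\dots$ of the snake triangulation of the $(n+3)$-gon with vertices $0,\dots,n+2$ in cyclic order. Identify the root $-\alpha_i$ with $\delta_i$, and the root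 $\alpha_i+\dots+\alpha_j$ ($i\le j$) with the internal diagonal that crosses $\delta_i,\dots,\delta_j$ and no other $\delta_k$. A polytope $\mathrm{CFZ}(A_n)$ is a polytope with normal fan consisting of the cones generated by the sets of roots identified with the sets of pairwise non-crossing internal diagonals (that is, by all subsets of clusters). \textbf{Theorem.} A polytope $\mathrm{CFZ}(A_n)$ exists, and a polytope $P$ is normally isomorphic both to $\mathrm{Ass}^{\mathrm I}(\sigma)$ for some $\sigma\in\{+,-\}^{n-1}$ and to an $\mathrm{Ass}^{\mathrm{II}}(T)$ for some triangulation $T$ of the $(n+3)$-gon if and only if $P$ is normally isomorphic to a polytope $\mathrm{CFZ}(A_n)$. In other words, the Hohlweg--Lange and the Santos families have, up to normal isomorphism, exactly one common member, the Chapoton--Fomin--Zelevinsky associahedron. -/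

import Mathlib

noncomputable section

/-! ### Polytopes, normal fans, normal isomorphism -/

/-- A polytope: the convex hull of finitely many points. -/
def IsPolytope {E : Type*} [AddCommGroup E] [Module ℝ E] (P : Set E) : Prop :=
  ∃ s : Set E, s.Finite ∧ P = convexHull ℝ s

/-- The (outer) normal cone of `P` at the point `x ∈ P`, i.e. the normal cone of the smallest
face of `P` containing `x`. It consists of the linear functionals on the direction space of `P`
that are maximized over `P` at `x`. Using the direction space `vectorSpan ℝ P` instead of the
ambient space means that normal vectors of a polytope which is not full-dimensional are considered
modulo the functionals that are constant on the polytope. -/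
def normalCone {E : Type*} [AddCommGroup E] [Module ℝ E] (P : Set E) (x : P) :
    Set (Module.Dual ℝ (vectorSpan ℝ P)) :=
  {φ | ∀ y : P, φ ⟨(y : E) -ᵥ (x : E), vsub_mem_vectorSpan ℝ y.2 x.2⟩ ≤ 0}

/-- The normal fan of `P`: the set of the normal cones of all nonempty faces of `P`
(each nonempty face of a polytope is the smallest face containing any of its relative interior
points, and each point lies in the relative interior of exactly one face). -/
def normalFan {E : Type*} [AddCommGroup E] [Module ℝ E] (P : Set E) :
    Set (Set (Module.Dual ℝ (vectorSpan ℝ P))) :=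
  Set.range (normalCone P)

/-- Two fans, given as sets of cones, are linearly isomorphic if some linear isomorphism of the
ambient spaces carries the cones of the first one onto the cones of the second one. -/
def LinearlyIsomorphic {V W : Type*} [AddCommGroup V] [Module ℝ V] [AddCommGroup W] [Module ℝ W]
    (F : Set (Set V)) (G : Set (Set W)) : Prop :=
  ∃ L : V ≃ₗ[ℝ] W, (fun C : Set V => L '' C) '' F = G

/-- Two polytopes are normally isomorphic if their normal fans are linearly isomorphic. -/
def NormallyIsomorphic {E E' : Type*} [AddCommGroup E] [Module ℝ E] [AddCommGroup E'] [Module ℝ E']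
    (P : Set E) (P' : Set E') : Prop :=
  LinearlyIsomorphic (normalFan P) (normalFan P')

/-- `P` is a polytope whose normal fan is the fan `F`; the dual of the direction space of `P`, in
which the normal fan lives, is identified with the ambient space of `F` by a linear isomorphism. -/
def IsPolytopeWithNormalFan {E V : Type*} [AddCommGroup E] [Module ℝ E] [AddCommGroup V]
    [Module ℝ V] (P : Set E) (F : Set (Set V)) : Prop :=
  IsPolytope P ∧ LinearlyIsomorphic (normalFan P) F

/-! ### Diagonals and triangulations of the `(n+3)`-gon -/

/-- The internal diagonals of a convex `(n+3)`-gon whose vertices are labelled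
`0, 1, …, n+2` in cyclic order. -/
abbrev Diagonal (n : ℕ) : Type :=
  {d : Fin (n + 3) × Fin (n + 3) //
    d.1.val + 1 < d.2.val ∧ ¬(d.1.val = 0 ∧ d.2.val = n + 2)}

/-- Two diagonals cross (in their relative interiors). -/
def Crosses {n : ℕ} (d e : Diagonal n) : Prop :=
  (d.1.1 < e.1.1 ∧ e.1.1 < d.1.2 ∧ d.1.2 < e.1.2) ∨
  (e.1.1 < d.1.1 ∧ d.1.1 < e.1.2 ∧ e.1.2 < d.1.2)

/-- A set of pairwise non-crossing diagonals. -/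
def NonCrossing {n : ℕ} (D : Set (Diagonal n)) : Prop :=
  ∀ d ∈ D, ∀ e ∈ D, ¬ Crosses d e

/-- A triangulation of the `(n+3)`-gon, given by its set of diagonals: an inclusion-maximal set of
pairwise non-crossing diagonals. -/
def IsTriangulation {n : ℕ} (T : Set (Diagonal n)) : Prop :=
  Maximal NonCrossing T

/-! ### Hohlweg–Lange associahedra -/

/-- The signs `+, -, σ, -, +` of the vertices `0, 1, …, n+2` of the polygon `P_{n+3}(σ)`;
`true` stands for `+` (the vertex is on the upper chain), `false` for `-` (lower chain). -/
def vertexSign (n : ℕ) (σ : Fin (n - 1) → Bool) (k : Fin (n + 3)) : Bool :=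
  if h : 2 ≤ k.val ∧ k.val ≤ n then σ ⟨k.val - 2, by omega⟩
  else if k.val = 0 ∨ k.val = n + 2 then true else false

/-- For vertices `i < j` of a convex polygon whose vertices are placed from left to right, those
with sign `+` along an upper chain from the leftmost to the rightmost vertex and those with sign `-`
along a lower one: the set of vertices strictly below the line `ij`.
A vertex horizontally between `i` and `j` is below the line iff it is on the lower chain; a vertex to
the left of `i` is below the line iff `i` is on the upper chain; a vertex to the right of `j` is below
the line iff `j` is on the upper chain. -/
def verticesBelow {N : ℕ} (s : Fin N → Bool) (i j : Fin N) : Set (Fin N) :=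
  {k | (i < k ∧ k < j ∧ s k = false) ∨ (k < i ∧ s i = true) ∨ (j < k ∧ s j = true)}

/-- In the same situation, the set of vertices strictly above the line `ij`. -/
def verticesAbove {N : ℕ} (s : Fin N → Bool) (i j : Fin N) : Set (Fin N) :=
  {k | (i < k ∧ k < j ∧ s k = true) ∨ (k < i ∧ s i = false) ∨ (j < k ∧ s j = false)}

/-- `ij` with `i < j` is an internal diagonal of `P_{n+3}(σ)` (labelled from left to right):
there are vertices of the polygon on both sides of it. -/
def IsHLDiagonal (n : ℕ) (σ : Fin (n - 1) → Bool) (i j : Fin (n + 3)) : Prop :=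
  i < j ∧ (verticesBelow (vertexSign n σ) i j).Nonempty ∧
    (verticesAbove (vertexSign n σ) i j).Nonempty

/-- The set `S_{ij}(σ)`: in the set of vertices strictly below `ij`, replace `0` by `i` and
`n+2` by `j`. -/
def hlSet (n : ℕ) (σ : Fin (n - 1) → Bool) (i j : Fin (n + 3)) : Set (Fin (n + 3)) :=
  (fun k : Fin (n + 3) => if k.val = 0 then i else if k.val = n + 2 then j else k) ''
    verticesBelow (vertexSign n σ) i j

open Classical in
/-- The elements of `S_{ij}(σ) ⊆ {1, …, n+1}`, as indices of the coordinates of `ℝ^{n+1}`;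
the index `m : Fin (n + 1)` stands for the coordinate `x_{m+1}`. -/
def hlIndexSet (n : ℕ) (σ : Fin (n - 1) → Bool) (i j : Fin (n + 3)) : Finset (Fin (n + 1)) :=
  Finset.univ.filter fun m => m.succ.castSucc ∈ hlSet n σ i j

/-- The Hohlweg–Lange associahedron `AssI(σ) ⊆ ℝ^{n+1}`. -/
def hohlwegLange (n : ℕ) (σ : Fin (n - 1) → Bool) : Set (Fin (n + 1) → ℝ) :=
  {x | (∀ i j, IsHLDiagonal n σ i j →
      ((hlIndexSet n σ i j).card : ℝ) * ((hlIndexSet n σ i j).card + 1) / 2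
        ≤ ∑ m ∈ hlIndexSet n σ i j, x m) ∧
    ∑ m, x m = ((n : ℝ) + 1) * (n + 2) / 2}

/-! ### Santos associahedra -/

open Classical in
/-- The vector attached to the diagonal `d` by the seed triangulation `T`, in the space `T → ℝ`
with standard basis `(α_δ)_{δ ∈ T}`: it is `-α_d` if `d ∈ T`, and otherwise the sum of the `α_δ` over
the diagonals `δ ∈ T` which `d` crosses. -/
def santosVector {n : ℕ} (T : Set (Diagonal n)) (d : Diagonal n) : T → ℝ :=
  if h : d ∈ T then -Pi.single (⟨d, h⟩ : T) 1
  else ∑ δ : T, if Crosses d δ.1 then Pi.single δ 1 else 0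

/-- The fan with seed triangulation `T`. Its maximal cones are generated by the triangulations of
the polygon, so its cones are those generated by the non-crossing sets of diagonals. -/
def santosFan {n : ℕ} (T : Set (Diagonal n)) : Set (Set (T → ℝ)) :=
  {C | ∃ D : Set (Diagonal n), NonCrossing D ∧
    C = (PointedCone.hull ℝ (santosVector T '' D) : Set (T → ℝ))}

/-- `P` is a Santos associahedron `AssII(T)`: a polytope whose normal fan is `santosFan T`. -/
def IsSantosAssociahedron {n : ℕ} {E : Type*} [AddCommGroup E] [Module ℝ E]
    (T : Set (Diagonal n)) (P : Set E) : Prop :=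
  IsPolytopeWithNormalFan P (santosFan T)

/-! ### Chapoton–Fomin–Zelevinsky associahedra -/

/-- The space spanned by the root system `A_n`: the vectors of `ℝ^{n+1}` with coordinate sum `0`. -/
def rootSpace (n : ℕ) : Submodule ℝ (Fin (n + 1) → ℝ) where
  carrier := {x | ∑ m, x m = 0}
  add_mem' := by
    intro x y hx hy
    change ∑ m, x m = 0 at hx
    change ∑ m, y m = 0 at hy
    change ∑ m, (x + y) m = 0
    simp [Finset.sum_add_distrib, hx, hy]
  zero_mem' := by simp
  smul_mem' := by
    intro c x hx
    change ∑ m, x m = 0 at hx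
    change ∑ m, (c • x) m = 0
    simp [← Finset.mul_sum, hx]

/-- The simple roots `α_i = e_i - e_{i+1}` of `A_n`. -/
def simpleRoot {n : ℕ} (i : Fin n) : rootSpace n :=
  ⟨Pi.single i.castSucc 1 - Pi.single i.succ 1, by
    show ∑ m, (Pi.single i.castSucc 1 - Pi.single i.succ 1 : Fin (n + 1) → ℝ) m = 0
    simp [Finset.sum_sub_distrib]⟩

/-- The diagonals of the snake (zigzag) triangulation, in the order in which they follow each other:
`{1, n+2}, {1, n+1}, {2, n+1}, {2, n}, {3, n}, …`. -/
def snakeDiagonal {n : ℕ} (i : Fin n) : Diagonal n :=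
  ⟨(⟨i.val / 2 + 1, by omega⟩, ⟨n + 2 - (i.val + 1) / 2, by omega⟩), by
    constructor
    · simp; omega
    · simp⟩

/-- `d` is the diagonal corresponding to the almost positive root `r`. The negative simple roots
`-α_i` correspond to the diagonals of the snake, and the positive root `α_i + ⋯ + α_j` to the diagonal
that crosses the snake diagonals corresponding to `-α_i, …, -α_j` and no others. -/
def IsRootOfDiagonal {n : ℕ} (r : rootSpace n) (d : Diagonal n) : Prop :=
  (∃ i : Fin n, r = -simpleRoot i ∧ d = snakeDiagonal i) ∨
  (∃ i j : Fin n, i ≤ j ∧ r = ∑ k ∈ Finset.Icc i j, simpleRoot k ∧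
    ∀ k : Fin n, Crosses d (snakeDiagonal k) ↔ k ∈ Finset.Icc i j)

/-- The cluster fan of type `A_n`. Its maximal cones are generated by the clusters, so its cones are
those generated by the simplices of the cluster complex, which are the sets of pairwise compatible
almost positive roots, that is, the sets of roots corresponding to non-crossing sets of diagonals. -/
def clusterFan (n : ℕ) : Set (Set (rootSpace n)) :=
  {C | ∃ D : Set (Diagonal n), NonCrossing D ∧
    C = (PointedCone.hull ℝ {r | ∃ d ∈ D, IsRootOfDiagonal r d} : Set (rootSpace n))}

/-- `P` is a Chapoton–Fomin–Zelevinsky associahedron `CFZ(A_n)`: a polytope whose normal fan is the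
cluster fan of type `A_n`. -/
def IsCFZAssociahedron (n : ℕ) {E : Type*} [AddCommGroup E] [Module ℝ E] (P : Set E) : Prop :=
  IsPolytopeWithNormalFan P (clusterFan n)

end

/-!
The idea is to compute the normal fans of all polytopes involved as fans of *compatible sets*: the
cones spanned by the sets of pairwise non-crossing members of a family of vectors indexed by
chords.

**Normal fan of a Hohlweg–Lange associahedron.** Adding the trivial inequalities, such a polytope
is described by all pairs `i < j` of positions of the polygon (`chainPolytope`); the pairs with a
nontrivial set of coordinates below them (`InnerPair`) give its facets. A general criterion
(`normalFan_eq_compatibleFan`) identifies the normal fan of a compact polyhedron with a fan of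
compatible sets, given three facts about the normals:

* Constraints that are tight at a common point do not cross (`not_crosses_of_tight`). For crossing
  chords with coordinate sets `S` and `S'`, the sets `S ∩ S'` and `S ∪ S'` belong to chords again,
  and `|S| (|S| + 1) / 2` is strictly supermodular.
* The normals of non-crossing chords are linearly independent (`eq_zero_of_sum_innerNormal`): some
  vector `e_b - e_a` pairs nontrivially with a shortest chord of the set and with no other.
* If two nonnegative combinations of normals of non-crossing chords agree, no chord of one crosses
  a chord of the other (`not_crosses_of_sum_eq`). Two crossing chords are separated by a vector
  `e_b - e_a` in opposite ways, while no chord of a non-crossing set separates against another.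

No vertices or triangulations have to be enumerated for this.

**The zigzag.** For alternating signs, relabelling the positions of the polygon cyclically turns
the crossing of chords into the usual one, the short inner chords into the snake, and the normals,
up to a change of signs of coordinates, into the almost positive roots. So the polytope with
alternating signs has the cluster fan as its normal fan (`normalFan_altSign_linearlyIsomorphic`);
projected along one coordinate, it is a Chapoton–Fomin–Zelevinsky associahedron. The same
coordinates show that the cluster fan is the Santos fan of the snake triangulation
(`clusterFan_linearlyIsomorphic_santosFan`).

**Uniqueness.** Suppose that the normal fan of a Hohlweg–Lange associahedron is isomorphic to a
Santos fan. Every initial segment `{1, …, k}` of the coordinates and its complement give antipodal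
rays, and antipodal rays of a Santos fan lie on coordinate axes, because all generators other than
the negatives of the basis vectors are nonnegative. An interior position `k` with negative sign
gives the ray of `{k}`, one with positive sign the ray of the complement of `{k}`. This ray is a
difference of the normals of two successive initial segments, so it has two nonzero coordinates,
which then are positive. Hence the direction in which the image of the normal of `{1, …, k}` points
along its axis is opposite to that for `{1, …, k - 1}` and determined by the sign of `k`; so the
signs alternate (`sign_alternates`). The remaining signs, those of the two leftmost and the two
rightmost vertices, do not affect the polytope as long as they differ in each pair
(`chainPolytope_congr`).
-/

/-! ### Fans of compatible sets and linear isomorphisms of fans -/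

section Fans

/-- The cones spanned by the compatible subsets of a family of vectors `v`, where a set of indices
is compatible if no two members are related by the incompatibility relation `cr`. Nothing is
required that would make this set of cones a fan. -/
def compatibleFan {ι V : Type*} [AddCommGroup V] [Module ℝ V] (cr : ι → ι → Prop) (v : ι → V) :
    Set (Set V) :=
  {C | ∃ D : Set ι, (∀ d ∈ D, ∀ e ∈ D, ¬ cr d e) ∧ C = (PointedCone.hull ℝ (v '' D) : Set V)}

theorem mem_hull_image_iff {ι V : Type*} [Fintype ι] [AddCommGroup V] [Module ℝ V] {v : ι → V}
    {A : Set ι} {x : V} : x ∈ PointedCone.hull ℝ (v '' A) ↔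
      ∃ g : ι → ℝ, (∀ i, 0 ≤ g i) ∧ (∀ i, i ∉ A → g i = 0) ∧ x = ∑ i, g i • v i := by
  classical
  constructor
  · intro hx
    induction hx using Submodule.span_induction with
    | mem x hx =>
      obtain ⟨i, hi, rfl⟩ := hx
      refine ⟨Pi.single i 1, fun j => ?_, fun j hj => ?_, ?_⟩
      · by_cases h : j = i
        · subst h; simp
        · simp [h]
      · rw [Pi.single_eq_of_ne]; rintro rfl; exact hj hi
      · simp [Pi.single_apply, ite_smul]
    | zero => exact ⟨0, by simp, by simp, by simp⟩
    | add x y _ _ hx hy =>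
      obtain ⟨g, hg, hgA, rfl⟩ := hx
      obtain ⟨g', hg', hgA', rfl⟩ := hy
      exact ⟨g + g', fun i => add_nonneg (hg i) (hg' i),
        fun i hi => by simp [hgA i hi, hgA' i hi], by simp [add_smul, Finset.sum_add_distrib]⟩
    | smul c x _ hx =>
      obtain ⟨g, hg, hgA, rfl⟩ := hx
      refine ⟨fun i => (c : ℝ) * g i, fun i => mul_nonneg c.2 (hg i),
        fun i hi => by simp [hgA i hi], ?_⟩
      rw [Finset.smul_sum]
      exact Finset.sum_congr rfl fun i _ => (mul_smul (c : ℝ) (g i) (v i)).symm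
  · rintro ⟨g, hg, hgA, rfl⟩
    refine Submodule.sum_mem _ fun i _ => ?_
    by_cases hi : i ∈ A
    · exact Submodule.smul_mem _ (⟨g i, hg i⟩ : NNReal) (Submodule.subset_span ⟨i, hi, rfl⟩)
    · rw [hgA i hi, zero_smul]; exact Submodule.zero_mem _

theorem sum_subtype_smul_eq {ι V : Type*} [Fintype ι] [AddCommGroup V] [Module ℝ V] (v : ι → V)
    (A : Set ι) [DecidablePred (· ∈ A)] (g : A → ℝ) :
    ∑ d : A, g d • v d = ∑ d, (if hd : d ∈ A then g ⟨d, hd⟩ else 0) • v d := by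
  rw [← Finset.sum_subset (Finset.subset_univ A.toFinset), ← Finset.sum_set_coe]
  · exact Finset.sum_congr rfl fun d _ => by rw [dif_pos d.2]
  · intro d _ hd
    rw [dif_neg (fun hd' => hd (by simpa using hd')), zero_smul]

theorem LinearlyIsomorphic.symm {V W : Type*} [AddCommGroup V] [Module ℝ V] [AddCommGroup W]
    [Module ℝ W] {F : Set (Set V)} {G : Set (Set W)} (h : LinearlyIsomorphic F G) :
    LinearlyIsomorphic G F := by
  obtain ⟨L, rfl⟩ := h
  refine ⟨L.symm, ?_⟩
  rw [Set.image_image]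
  simp [Set.image_image]

theorem LinearlyIsomorphic.trans {V W X : Type*} [AddCommGroup V] [Module ℝ V] [AddCommGroup W]
    [Module ℝ W] [AddCommGroup X] [Module ℝ X] {F : Set (Set V)} {G : Set (Set W)}
    {H : Set (Set X)} (h : LinearlyIsomorphic F G) (h' : LinearlyIsomorphic G H) :
    LinearlyIsomorphic F H := by
  obtain ⟨L, rfl⟩ := h
  obtain ⟨M, rfl⟩ := h'
  refine ⟨L.trans M, ?_⟩
  rw [Set.image_image]
  simp only [Set.image_image]
  rfl

theorem linearlyIsomorphic_compatibleFan {ι V W : Type*} [AddCommGroup V] [Module ℝ V]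
    [AddCommGroup W] [Module ℝ W] {cr : ι → ι → Prop} {v : ι → V} {v' : ι → W} (L : V ≃ₗ[ℝ] W)
    (h : ∀ i, L (v i) = v' i) : LinearlyIsomorphic (compatibleFan cr v) (compatibleFan cr v') := by
  have hcone : ∀ D : Set ι, L '' (PointedCone.hull ℝ (v '' D) : Set V) =
      (PointedCone.hull ℝ (v' '' D) : Set W) := by
    intro D
    have h1 := Submodule.map_span (L.toLinearMap.restrictScalars NNReal) (v '' D)
    have h2 : (L.toLinearMap.restrictScalars NNReal) '' (v '' D) = v' '' D := by
      rw [Set.image_image]; exact Set.image_congr fun i _ => h i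
    rw [h2] at h1
    exact congrArg (fun S : Submodule NNReal W => (S : Set W)) h1
  refine ⟨L, ?_⟩
  ext C
  constructor
  · rintro ⟨_, ⟨D, hD, rfl⟩, rfl⟩
    exact ⟨D, hD, hcone D⟩
  · rintro ⟨D, hD, rfl⟩
    exact ⟨_, ⟨D, hD, rfl⟩, hcone D⟩

theorem compatibleFan_comp {ι κ V : Type*} [AddCommGroup V] [Module ℝ V] {cr : ι → ι → Prop}
    {cr' : κ → κ → Prop} (v : κ → V) {f : ι → κ} (hf : Function.Surjective f)
    (h : ∀ i j, cr' (f i) (f j) ↔ cr i j) : compatibleFan cr' v = compatibleFan cr (v ∘ f) := by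
  ext C
  constructor
  · rintro ⟨D, hD, rfl⟩
    refine ⟨f ⁻¹' D, fun i hi j hj => ?_, ?_⟩
    · rw [← h]; exact hD _ hi _ hj
    · rw [Set.image_comp, Set.image_preimage_eq D hf]
  · rintro ⟨D, hD, rfl⟩
    refine ⟨f '' D, ?_, by rw [Set.image_comp]⟩
    rintro _ ⟨i, hi, rfl⟩ _ ⟨j, hj, rfl⟩
    rw [h]; exact hD i hi j hj

theorem mem_hull_singleton {V : Type*} [AddCommGroup V] [Module ℝ V] {x y : V} :
    x ∈ PointedCone.hull ℝ {y} ↔ ∃ c : ℝ, 0 ≤ c ∧ x = c • y := by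
  rw [Submodule.mem_span_singleton]
  constructor
  · rintro ⟨c, rfl⟩; exact ⟨c, c.2, rfl⟩
  · rintro ⟨c, hc, rfl⟩; exact ⟨⟨c, hc⟩, rfl⟩

/-- A linear isomorphism between two fans of compatible sets carries the ray of each vector of the
first family onto the ray of some vector of the second. The image of a ray is a cone of the second
fan, and each nonzero generator of this cone spans it, since the cone is a ray. -/
theorem exists_pos_smul_of_image_compatibleFan {ι κ V W : Type*} [Fintype κ] [AddCommGroup V]
    [Module ℝ V] [AddCommGroup W] [Module ℝ W] {cr : ι → ι → Prop} {cr' : κ → κ → Prop}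
    {v : ι → V} {v' : κ → W} (L : V ≃ₗ[ℝ] W)
    (hL : (fun C : Set V => L '' C) '' compatibleFan cr v = compatibleFan cr' v')
    (d : ι) (hd : ¬ cr d d) (hvd : v d ≠ 0) :
    ∃ e : κ, ∃ c : ℝ, 0 < c ∧ L (v d) = c • v' e := by
  have hmem : L '' (PointedCone.hull ℝ (v '' {d}) : Set V) ∈ compatibleFan cr' v' := by
    rw [← hL]
    exact ⟨_, ⟨{d}, by simpa using hd, rfl⟩, rfl⟩
  obtain ⟨D, -, hD⟩ := hmem
  rw [Set.image_singleton] at hD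
  have h1 : L (v d) ∈ PointedCone.hull ℝ (v' '' D) := by
    rw [← SetLike.mem_coe, ← hD]
    exact ⟨_, mem_hull_singleton.mpr ⟨1, zero_le_one, (one_smul _ _).symm⟩, rfl⟩
  obtain ⟨g, -, hgD, hg⟩ := mem_hull_image_iff.mp h1
  obtain ⟨e, heD, he⟩ : ∃ e ∈ D, v' e ≠ 0 := by
    by_contra hc
    push Not at hc
    refine hvd (L.map_eq_zero_iff.mp (hg.trans (Finset.sum_eq_zero fun e _ => ?_)))
    by_cases heD : e ∈ D
    · rw [hc e heD, smul_zero]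
    · rw [hgD e heD, zero_smul]
  have h2 : v' e ∈ L '' (PointedCone.hull ℝ {v d} : Set V) := by
    rw [hD]; exact Submodule.subset_span ⟨e, heD, rfl⟩
  obtain ⟨y, hy, hye⟩ := h2
  obtain ⟨c, hc, rfl⟩ := mem_hull_singleton.mp hy
  have hc0 : c ≠ 0 := by
    rintro rfl
    exact he (by rw [← hye, zero_smul, map_zero])
  refine ⟨e, c⁻¹, inv_pos.mpr (lt_of_le_of_ne hc hc0.symm), ?_⟩
  rw [← hye, map_smul, smul_smul, inv_mul_cancel₀ hc0, one_smul]

/-- A linear map that is injective on the direction space of a set carries its normal fan to an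
isomorphic one. -/
theorem normalFan_image_linearlyIsomorphic {E E' : Type*} [AddCommGroup E] [Module ℝ E]
    [AddCommGroup E'] [Module ℝ E'] (f : E →ₗ[ℝ] E') {P : Set E}
    (hf : ∀ w ∈ vectorSpan ℝ P, f w = 0 → w = 0) :
    LinearlyIsomorphic (normalFan (f '' P)) (normalFan P) := by
  have hspan : (vectorSpan ℝ P).map f = vectorSpan ℝ (f '' P) :=
    f.toAffineMap.map_vectorSpan
  have hinj : Function.Injective (f.domRestrict (vectorSpan ℝ P)) := by
    rw [← LinearMap.ker_eq_bot, LinearMap.ker_eq_bot']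
    exact fun w hw => Subtype.ext (hf w w.2 hw)
  let e : vectorSpan ℝ P ≃ₗ[ℝ] vectorSpan ℝ (f '' P) :=
    (LinearEquiv.ofInjective _ hinj).trans
      (LinearEquiv.ofEq _ _ (by rw [LinearMap.range_domRestrict, hspan]))
  have he : ∀ w, (e w : E') = f w := fun w => rfl
  have hcone : ∀ x : P, e.dualMap '' normalCone (f '' P) ⟨f x, x, x.2, rfl⟩ = normalCone P x := by
    intro x
    ext φ
    constructor
    · rintro ⟨ψ, hψ, rfl⟩ y
      have := hψ ⟨f y, y, y.2, rfl⟩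
      rw [LinearEquiv.dualMap_apply]
      convert this using 2
      exact Subtype.ext (by rw [he]; exact map_sub f (y : E) x)
    · intro hφ
      refine ⟨e.symm.dualMap φ, ?_, ?_⟩
      · rintro ⟨_, y, hy, rfl⟩
        rw [LinearEquiv.dualMap_apply]
        have := hφ ⟨y, hy⟩
        convert this using 2
        rw [LinearEquiv.symm_apply_eq]
        exact Subtype.ext (by rw [he]; exact (map_sub f y (x : E)).symm)
      · ext w; simp [LinearEquiv.dualMap_apply]
  refine ⟨e.dualMap, ?_⟩
  ext C
  constructor
  · rintro ⟨_, ⟨⟨_, x, hx, rfl⟩, rfl⟩, rfl⟩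
    exact ⟨⟨x, hx⟩, (hcone ⟨x, hx⟩).symm⟩
  · rintro ⟨x, rfl⟩
    exact ⟨_, ⟨_, rfl⟩, hcone x⟩

end Fans

/-! ### Polyhedra and their normal fans -/

section Polyhedra

/-- Linearly independent functionals take any prescribed values at some common point. -/
theorem exists_forall_apply_eq {κ V : Type*} [AddCommGroup V] [Module ℝ V] [FiniteDimensional ℝ V]
    {f : κ → Module.Dual ℝ V} (hf : LinearIndependent ℝ f) (t : κ → ℝ) :
    ∃ w : V, ∀ a, f a w = t a := by
  obtain ⟨ψ, hψ⟩ : ∃ ψ : Module.Dual ℝ (Module.Dual ℝ V), ∀ a, ψ (f a) = t a := by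
    let b := Module.Basis.span hf
    obtain ⟨ψ, hψ⟩ := LinearMap.exists_extend (b.constr ℝ t)
    refine ⟨ψ, fun a => ?_⟩
    have h1 : ψ ((b a : Submodule.span ℝ (Set.range f)) : Module.Dual ℝ V) = t a := by
      have := LinearMap.congr_fun hψ (b a)
      simpa using this
    rwa [Module.Basis.span_apply] at h1
  refine ⟨(Module.evalEquiv ℝ V).symm ψ, fun a => ?_⟩
  rw [← hψ a, Module.apply_evalEquiv_symm_apply]

variable {E ι : Type*} [NormedAddCommGroup E] [NormedSpace ℝ E] [Fintype ι]

/-- A point of a polyhedron can be moved a little in every direction along which the constraints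
active at it do not increase; the constraints active after the move are the active ones that are
constant along the direction. -/
theorem exists_small_move (u : ι → Module.Dual ℝ E) (h : ι → ℝ) {x w : E}
    (hx : ∀ d, u d x ≤ h d) (hw : ∀ d, u d x = h d → u d w ≤ 0) :
    ∃ ε : ℝ, 0 < ε ∧ ∀ d, u d (x + ε • w) ≤ h d ∧
      (u d (x + ε • w) = h d → u d x = h d ∧ u d w = 0) := by
  have key : ∀ d, ∀ᶠ ε : ℝ in nhdsWithin 0 (Set.Ioi 0), u d (x + ε • w) ≤ h d ∧
      (u d (x + ε • w) = h d → u d x = h d ∧ u d w = 0) := by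
    intro d
    by_cases hd : u d x = h d
    · filter_upwards [self_mem_nhdsWithin] with ε (hε : 0 < ε)
      have := hw d hd
      simp only [map_add, map_smul, smul_eq_mul]
      refine ⟨by nlinarith, fun he => ⟨hd, ?_⟩⟩
      have h0 : ε * u d w = 0 := by linarith
      exact (mul_eq_zero.mp h0).resolve_left hε.ne'
    · have hlt : u d x < h d := lt_of_le_of_ne (hx d) hd
      have hc : Filter.Tendsto (fun ε : ℝ => u d (x + ε • w)) (nhds 0) (nhds (u d x)) := by
        have : Continuous fun ε : ℝ => u d (x + ε • w) := by
          simp only [map_add, map_smul, smul_eq_mul]; fun_prop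
        simpa using this.tendsto 0
      filter_upwards [nhdsWithin_le_nhds (hc.eventually_lt_const hlt)] with ε hε
      exact ⟨hε.le, fun he => absurd he hε.ne⟩
  have hall := (Filter.eventually_all.mpr key).and self_mem_nhdsWithin
  obtain ⟨ε, h1, h2⟩ := hall.exists
  exact ⟨ε, h2, h1⟩

/-- A compact polyhedron is a polytope: an extreme point is determined by the constraints active at
it, so there are finitely many extreme points. -/
theorem isPolytope_of_isCompact [FiniteDimensional ℝ E] (u : ι → Module.Dual ℝ E) (h : ι → ℝ)
    {P : Set E} {W : Submodule ℝ E}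
    {c : E} (hP : ∀ x, x ∈ P ↔ x - c ∈ W ∧ ∀ d, u d x ≤ h d) (hcomp : IsCompact P) :
    IsPolytope P := by
  have hconv : Convex ℝ P := by
    intro x hx y hy a b ha hb hab
    rw [hP] at hx hy ⊢
    refine ⟨?_, fun d => ?_⟩
    · have : a • x + b • y - c = a • (x - c) + b • (y - c) := by
        rw [smul_sub, smul_sub]
        nth_rw 1 [← one_smul ℝ c, ← hab, add_smul]
        abel
      rw [this]
      exact W.add_mem (W.smul_mem _ hx.1) (W.smul_mem _ hy.1)
    · have h1 := mul_le_mul_of_nonneg_left (hx.2 d) ha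
      have h2 := mul_le_mul_of_nonneg_left (hy.2 d) hb
      have h3 : h d = a * h d + b * h d := by rw [← add_mul, hab, one_mul]
      simp only [map_add, map_smul, smul_eq_mul]
      linarith
  have hinj : Set.InjOn (fun x => {d | u d x = h d}) (P.extremePoints ℝ) := by
    intro x hx y hy hxy
    by_contra hne
    have hxP := (hP x).mp hx.1
    have hyP := (hP y).mp hy.1
    have hxy' : ∀ d, u d x = h d → u d y = h d := fun d hd => by
      have : d ∈ {d | u d y = h d} := by
        have h0 : d ∈ {d | u d x = h d} := hd
        rwa [show {d | u d x = h d} = {d | u d y = h d} from hxy] at h0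
      exact this
    obtain ⟨ε, hε, hm⟩ := exists_small_move u h (w := x - y) hxP.2
      (fun d hd => by simp [hd, hxy' d hd])
    have hz : x + ε • (x - y) ∈ P := by
      rw [hP]
      refine ⟨?_, fun d => (hm d).1⟩
      have : x + ε • (x - y) - c = (x - c) + ε • ((x - c) - (y - c)) := by
        rw [sub_sub_sub_cancel_right]; abel
      rw [this]
      exact W.add_mem hxP.1 (W.smul_mem _ (W.sub_mem hxP.1 hyP.1))
    -- `x` lies strictly between `y` and the moved point
    have hseg : x ∈ openSegment ℝ y (x + ε • (x - y)) := by
      refine ⟨ε / (1 + ε), 1 / (1 + ε), by positivity, by positivity, by field_simp; ring, ?_⟩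
      have : (1 + ε) ≠ 0 := by positivity
      have key : (1 + ε) • ((ε / (1 + ε)) • y + (1 / (1 + ε)) • (x + ε • (x - y))) =
          (1 + ε) • x := by
        rw [smul_add, smul_smul, smul_smul, mul_div_cancel₀ _ this, mul_div_cancel₀ _ this]
        module
      exact smul_right_injective E this key
    exact hne (hx.2 hy.1 hz hseg).symm
  -- an extreme point is determined by its active set, and there are finitely many such sets
  have hfin : (P.extremePoints ℝ).Finite := Set.Finite.of_finite_image (Set.toFinite _) hinj
  refine ⟨_, hfin, ?_⟩
  rw [← closure_convexHull_extremePoints hcomp hconv]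
  conv_rhs => rw [closure_convexHull_extremePoints hcomp hconv]
  exact (hfin.isCompact_convexHull ℝ).isClosed.closure_eq

/-- The normal cone at a point of a polyhedron at which the active constraints are linearly
independent is spanned by these constraints. -/
theorem normalCone_eq_hull [FiniteDimensional ℝ E] (u : ι → Module.Dual ℝ E) (h : ι → ℝ)
    {P : Set E} {c : E}
    (hP : ∀ x, x ∈ P ↔ x - c ∈ vectorSpan ℝ P ∧ ∀ d, u d x ≤ h d) (x : P)
    (hli : LinearIndependent ℝ fun d : {d | u d x = h d} => (u d).comp (vectorSpan ℝ P).subtype) :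
    normalCone P x = (PointedCone.hull ℝ
      ((fun d => (u d).comp (vectorSpan ℝ P).subtype) '' {d | u d x = h d}) : Set _) := by
  classical
  ext φ
  rw [SetLike.mem_coe, mem_hull_image_iff]
  constructor
  · intro hφ
    have hmove : ∀ w : vectorSpan ℝ P, (∀ d, u d x = h d → u d w ≤ 0) → φ w ≤ 0 := by
      intro w hw
      obtain ⟨ε, hε, hm⟩ := exists_small_move u h ((hP x).mp x.2).2 hw
      have hz : (x : E) + ε • (w : E) ∈ P := by
        rw [hP]
        refine ⟨?_, fun d => (hm d).1⟩
        rw [add_sub_right_comm]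
        exact Submodule.add_mem _ ((hP x).mp x.2).1 (Submodule.smul_mem _ _ w.2)
      have := hφ ⟨_, hz⟩
      have heq : (⟨((x : E) + ε • (w : E)) -ᵥ (x : E), vsub_mem_vectorSpan ℝ hz x.2⟩ :
          vectorSpan ℝ P) = ε • w := by
        ext; simp
      rw [heq, map_smul, smul_eq_mul] at this
      by_contra hcon
      push Not at hcon
      have := mul_pos hε hcon
      linarith
    -- `φ` vanishes on the directions along which all active constraints are constant
    have hspan : φ ∈ Submodule.span ℝ (Set.range fun d : {d | u d x = h d} =>
        (u d).comp (vectorSpan ℝ P).subtype) := by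
      refine mem_span_of_iInf_ker_le_ker fun w hw => ?_
      simp only [Submodule.mem_iInf, LinearMap.mem_ker, LinearMap.comp_apply,
        Submodule.subtype_apply] at hw ⊢
      refine le_antisymm (hmove w fun d hd => (hw ⟨d, hd⟩).le) ?_
      have := hmove (-w) fun d hd => by
        rw [Submodule.coe_neg, map_neg, hw ⟨d, hd⟩, neg_zero]
      rw [map_neg] at this
      linarith
    obtain ⟨g, hg⟩ := (Submodule.mem_span_range_iff_exists_fun ℝ).mp hspan
    refine ⟨fun d => if hd : u d x = h d then g ⟨d, hd⟩ else 0, fun d => ?_, fun d hd => ?_, ?_⟩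
    · by_cases hd : u d x = h d
      · simp only [hd, dite_true]
        -- test `φ` on the direction that decreases the constraint `d` only
        obtain ⟨w, hw⟩ := exists_forall_apply_eq hli (fun e => if e.1 = d then -1 else 0)
        have hle := hmove w fun e he => by
          have := hw ⟨e, he⟩
          simp only [LinearMap.comp_apply, Submodule.subtype_apply] at this
          rw [this]; split_ifs <;> norm_num
        have : φ w = - g ⟨d, hd⟩ := by
          rw [← hg, LinearMap.sum_apply]
          simp only [LinearMap.smul_apply, hw]
          rw [Finset.sum_eq_single ⟨d, hd⟩]
          · simp
          · rintro ⟨e, he⟩ _ hne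
            have : e ≠ d := fun h => hne (Subtype.ext h)
            simp [this]
          · simp
        linarith
      · simp [hd]
    · exact dif_neg hd
    · rw [← hg]
      exact sum_subtype_smul_eq (fun d => (u d).comp (vectorSpan ℝ P).subtype)
        {d | u d x = h d} g
  · rintro ⟨g, hg, hgA, rfl⟩ y
    rw [LinearMap.sum_apply]
    refine Finset.sum_nonpos fun d _ => ?_
    by_cases hd : u d x = h d
    · have := ((hP y).mp y.2).2 d
      refine mul_nonpos_of_nonneg_of_nonpos (hg d) ?_
      simp only [LinearMap.comp_apply, Submodule.subtype_apply, vsub_eq_sub, map_sub]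
      linarith
    · rw [hgA d hd]; simp

/-- The normal fan of a compact polyhedron whose active sets are compatible, if the compatible sets
of constraints are linearly independent and any two nonnegative combinations of compatible sets
that agree have jointly compatible supports. Under these assumptions a functional has at most one
expression as a nonnegative combination of a compatible set. Hence every compatible set is the
active set of some point: the active set of a maximizer of the sum of its members contains it, and
a small move leaves the superfluous constraints. -/
theorem normalFan_eq_compatibleFan [FiniteDimensional ℝ E] (cr : ι → ι → Prop)
    (u : ι → Module.Dual ℝ E) (h : ι → ℝ) {P : Set E} {c : E}
    (hP : ∀ x, x ∈ P ↔ x - c ∈ vectorSpan ℝ P ∧ ∀ d, u d x ≤ h d)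
    (hcomp : IsCompact P) (hne : P.Nonempty)
    (hactive : ∀ x ∈ P, ∀ d e, u d x = h d → u e x = h e → ¬ cr d e)
    (hindep : ∀ g : ι → ℝ, (∀ d e, g d ≠ 0 → g e ≠ 0 → ¬ cr d e) →
      ∑ d, g d • (u d).comp (vectorSpan ℝ P).subtype = 0 → g = 0)
    (hjoint : ∀ f g : ι → ℝ, (∀ d, 0 ≤ f d) → (∀ d, 0 ≤ g d) →
      (∀ d e, f d ≠ 0 → f e ≠ 0 → ¬ cr d e) → (∀ d e, g d ≠ 0 → g e ≠ 0 → ¬ cr d e) →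
      (∑ d, f d • (u d).comp (vectorSpan ℝ P).subtype =
        ∑ d, g d • (u d).comp (vectorSpan ℝ P).subtype) → ∀ d e, f d ≠ 0 → g e ≠ 0 → ¬ cr d e) :
    normalFan P = compatibleFan cr fun d => (u d).comp (vectorSpan ℝ P).subtype := by
  classical
  have hli : ∀ A : Set ι, (∀ d ∈ A, ∀ e ∈ A, ¬ cr d e) →
      LinearIndependent ℝ fun d : A => (u d).comp (vectorSpan ℝ P).subtype := by
    intro A hA
    rw [Fintype.linearIndependent_iff]
    intro g hg d
    rw [sum_subtype_smul_eq (fun d => (u d).comp (vectorSpan ℝ P).subtype)] at hg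
    have := congrFun (hindep _ (fun d e hd he => hA d (by by_contra hc; simp [hc] at hd) e
      (by by_contra hc; simp [hc] at he)) hg) d
    simpa using this
  have huniq : ∀ f g : ι → ℝ, (∀ d, 0 ≤ f d) → (∀ d, 0 ≤ g d) →
      (∀ d e, f d ≠ 0 → f e ≠ 0 → ¬ cr d e) → (∀ d e, g d ≠ 0 → g e ≠ 0 → ¬ cr d e) →
      (∑ d, f d • (u d).comp (vectorSpan ℝ P).subtype =
        ∑ d, g d • (u d).comp (vectorSpan ℝ P).subtype) → f = g := by
    intro f g hf hg hfc hgc hfg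
    have h1 := hjoint f g hf hg hfc hgc hfg
    have h2 := hjoint g f hg hf hgc hfc hfg.symm
    refine sub_eq_zero.mp (hindep (f - g) (fun d e hd he => ?_) ?_)
    · have key : ∀ d, (f - g) d ≠ 0 → f d ≠ 0 ∨ g d ≠ 0 := fun d hd => by
        by_contra hc
        push Not at hc
        simp [hc.1, hc.2] at hd
      rcases key d hd with hd | hd <;> rcases key e he with he | he
      · exact hfc d e hd he
      · exact h1 d e hd he
      · exact h2 d e hd he
      · exact hgc d e hd he
    · rw [← sub_eq_zero, ← Finset.sum_sub_distrib] at hfg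
      rw [← hfg]
      exact Finset.sum_congr rfl fun d _ => by ext w; simp [sub_mul]
  have hcone : ∀ x : P, normalCone P x = (PointedCone.hull ℝ
      ((fun d => (u d).comp (vectorSpan ℝ P).subtype) '' {d | u d x = h d}) : Set _) := fun x =>
    normalCone_eq_hull u h hP x (hli _ fun d hd e he => hactive x x.2 d e hd he)
  ext C
  constructor
  · rintro ⟨x, rfl⟩
    exact ⟨_, fun d hd e he => hactive x x.2 d e hd he, hcone x⟩
  · rintro ⟨D, hD, rfl⟩
    let φ : E →ₗ[ℝ] ℝ := ∑ d, (if d ∈ D then (1 : ℝ) else 0) • u d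
    obtain ⟨x, hx, hmax⟩ := hcomp.exists_isMaxOn hne
      (LinearMap.continuous_of_finiteDimensional φ).continuousOn
    have hφ : φ.comp (vectorSpan ℝ P).subtype ∈ normalCone P ⟨x, hx⟩ := fun y => by
      have := hmax y.2
      simp only [Set.mem_ofPred_eq] at this
      simp only [LinearMap.comp_apply, Submodule.subtype_apply, vsub_eq_sub, map_sub]
      linarith
    rw [hcone, SetLike.mem_coe, mem_hull_image_iff] at hφ
    obtain ⟨g, hg, hgA, hφg⟩ := hφ
    -- the expression of `φ` by the active constraints is the one that defines it
    have hsub : ∀ d ∈ D, u d x = h d := by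
      have := huniq (fun d => if d ∈ D then 1 else 0) g (fun d => by split_ifs <;> norm_num) hg
        (fun d e hd he => hD d (by by_contra hc; simp [hc] at hd) e
          (by by_contra hc; simp [hc] at he))
        (fun d e hd he => hactive x hx d e (by by_contra hc; exact hd (hgA d hc))
          (by by_contra hc; exact he (hgA e hc)))
        (by rw [← hφg]; ext w
            simp only [φ, LinearMap.comp_apply, LinearMap.sum_apply, LinearMap.smul_apply])
      intro d hd
      by_contra hc
      have h1 := congrFun this d
      simp [hd, hgA d hc] at h1
    -- move in a direction that keeps the constraints of `D` active and relaxes the other ones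
    obtain ⟨w, hw⟩ := exists_forall_apply_eq
      (hli {d | u d x = h d} fun d hd e he => hactive x hx d e hd he)
      (fun d => if d.1 ∈ D then 0 else -1)
    have hw' : ∀ d, u d x = h d → u d w = if d ∈ D then 0 else -1 := fun d hd => hw ⟨d, hd⟩
    obtain ⟨ε, hε, hm⟩ := exists_small_move u h (w := (w : E)) ((hP x).mp hx).2 (fun d hd => by
      rw [hw' d hd]; split_ifs <;> norm_num)
    have hz : x + ε • (w : E) ∈ P := by
      rw [hP]
      refine ⟨?_, fun d => (hm d).1⟩
      rw [add_sub_right_comm]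
      exact Submodule.add_mem _ ((hP x).mp hx).1 (Submodule.smul_mem _ _ w.2)
    refine ⟨⟨_, hz⟩, ?_⟩
    rw [hcone]
    have hset : {d | u d (x + ε • (w : E)) = h d} = D := by
      ext d
      constructor
      · intro hd
        obtain ⟨h1, h2⟩ := (hm d).2 hd
        by_contra hc
        rw [hw' d h1, if_neg hc] at h2
        norm_num at h2
      · intro hd
        have h1 := hsub d hd
        have h2 := hw' d h1
        rw [if_pos hd] at h2
        simp [h1, h2]
    simp only [hset]

end Polyhedra

/-! ### Chords of a polygon with an upper and a lower chain -/

/-- For a polygon with signs `s` (`true` for the upper chain), the position `m` counts for the set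
`S_{ij}` of the chord `ij`. Inner positions `m ≠ i, j` count if the vertex `m` lies strictly below
the chord. The end point `i` counts if it replaces the leftmost vertex `0`, that is, if `i` lies on
the upper chain, and likewise `j`. -/
def Below (s : ℕ → Bool) (i j m : ℕ) : Prop :=
  (m ≤ i ∧ s i = true) ∨ (i < m ∧ m < j ∧ s m = false) ∨ (j ≤ m ∧ s j = true)

/-- The chords `ij` and `kl` cross, in terms of positions from left to right and of the signs of
the end points: overlapping chords cross if their inner end points lie on the same chain, nested
ones if the end points of the inner chord lie on different chains. -/
def ChainCrosses (s : ℕ → Bool) (i j k l : ℕ) : Prop :=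
  (i < k ∧ k < j ∧ j < l ∧ s k = s j) ∨ (k < i ∧ i < l ∧ l < j ∧ s i = s l) ∨
  (i < k ∧ k < l ∧ l < j ∧ s k ≠ s l) ∨ (k < i ∧ i < j ∧ j < l ∧ s i ≠ s j)

/-- Crossing chords separate two positions in opposite ways. The positions are those two of the
four end points that are neither leftmost nor rightmost. -/
theorem ChainCrosses.exists_separated {s : ℕ → Bool} {i j k l : ℕ} (h : ChainCrosses s i j k l) :
    ∃ a b, i ≤ a ∧ a ≤ j ∧ k ≤ a ∧ a ≤ l ∧ i ≤ b ∧ b ≤ j ∧ k ≤ b ∧ b ≤ l ∧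
      min i k < a ∧ a < max j l ∧ min i k < b ∧ b < max j l ∧
      Below s i j a ∧ ¬ Below s k l a ∧ Below s k l b ∧ ¬ Below s i j b := by
  unfold ChainCrosses at h
  rcases h with h | h | h | h
  · cases hk : s k
    · refine ⟨k, j, ?_⟩; unfold Below; grind
    · refine ⟨j, k, ?_⟩; unfold Below; grind
  · cases hk : s i
    · refine ⟨l, i, ?_⟩; unfold Below; grind
    · refine ⟨i, l, ?_⟩; unfold Below; grind
  · cases hk : s k
    · refine ⟨k, l, ?_⟩; unfold Below; grind
    · refine ⟨l, k, ?_⟩; unfold Below; grind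
  · cases hk : s i
    · refine ⟨j, i, ?_⟩; unfold Below; grind
    · refine ⟨i, j, ?_⟩; unfold Below; grind

/-- If two positions in the range of a chord `ij` are separated by it, a chord not crossing `ij`
does not separate them in the opposite way. -/
theorem below_of_not_chainCrosses {s : ℕ → Bool} {i j k l a b : ℕ} (hij : i < j) (hkl : k < l)
    (h : ¬ ChainCrosses s i j k l) (ha : i ≤ a) (ha' : a ≤ j) (hb : i ≤ b) (hb' : b ≤ j)
    (h1 : Below s i j a) (h2 : ¬ Below s i j b) (h3 : Below s k l b) : Below s k l a := by
  unfold ChainCrosses Below at *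
  grind

/-- The positions below both of two crossing chords, and those below at least one of them, are the
positions below two other chords on the same four end points. -/
theorem exists_inter_union {s : ℕ → Bool} {i j k l N : ℕ} (h : ChainCrosses s i j k l)
    (hj : j ≤ N) (hl : l ≤ N) :
    ∃ p q p' q', p < q ∧ q ≤ N ∧ p' < q' ∧ q' ≤ N ∧
      (∀ m, Below s p q m ↔ Below s i j m ∧ Below s k l m) ∧
      (∀ m, Below s p' q' m ↔ Below s i j m ∨ Below s k l m) := by
  have overlapping : ∀ {i j k l : ℕ}, i < k ∧ k < j ∧ j < l ∧ s k = s j → j ≤ N → l ≤ N →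
      ∃ p q p' q', p < q ∧ q ≤ N ∧ p' < q' ∧ q' ≤ N ∧
      (∀ m, Below s p q m ↔ Below s i j m ∧ Below s k l m) ∧
      (∀ m, Below s p' q' m ↔ Below s i j m ∨ Below s k l m) := by
    intro i j k l h hj hl
    cases hk : s k
    · exact ⟨k, j, i, l, by omega, by omega, by omega, by omega, by unfold Below; grind,
        by unfold Below; grind⟩
    · exact ⟨i, l, k, j, by omega, by omega, by omega, by omega, by unfold Below; grind,
        by unfold Below; grind⟩
  have nested : ∀ {i j k l : ℕ}, i < k ∧ k < l ∧ l < j ∧ s k ≠ s l → j ≤ N → l ≤ N →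
      ∃ p q p' q', p < q ∧ q ≤ N ∧ p' < q' ∧ q' ≤ N ∧
      (∀ m, Below s p q m ↔ Below s i j m ∧ Below s k l m) ∧
      (∀ m, Below s p' q' m ↔ Below s i j m ∨ Below s k l m) := by
    intro i j k l h hj hl
    cases hk : s k
    · exact ⟨k, j, i, l, by omega, by omega, by omega, by omega, by unfold Below; grind,
        by unfold Below; grind⟩
    · exact ⟨i, l, k, j, by omega, by omega, by omega, by omega, by unfold Below; grind,
        by unfold Below; grind⟩
  rcases h with h | h | h | h
  · exact overlapping h hj hl
  · simpa only [and_comm, or_comm] using overlapping h hl hj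
  · exact nested h hj hl
  · simpa only [and_comm, or_comm] using nested h hl hj

/-- Two positions that are separated by a shortest chord of a non-crossing set and by no other
chord of the set. -/
theorem exists_separated_only_by_shortest {s : ℕ → Bool} {N i j : ℕ} {A : Set (ℕ × ℕ)}
    (hA : ∀ d ∈ A, d.1 < d.2 ∧ d.2 ≤ N)
    (hnc : ∀ d ∈ A, ∀ e ∈ A, ¬ ChainCrosses s d.1 d.2 e.1 e.2) (he : (i, j) ∈ A)
    (hmin : ∀ d ∈ A, j - i ≤ d.2 - d.1)
    (ha : ∃ a, 1 ≤ a ∧ a < N ∧ Below s i j a) (hb : ∃ b, 1 ≤ b ∧ b < N ∧ ¬ Below s i j b) :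
    ∃ a b, (1 ≤ a ∧ a < N ∧ Below s i j a) ∧ (1 ≤ b ∧ b < N ∧ ¬ Below s i j b) ∧
      ∀ d ∈ A, d ≠ (i, j) → (Below s d.1 d.2 a ↔ Below s d.1 d.2 b) := by
  have hij := hA _ he
  simp only at hij
  obtain ⟨a, ha1, haN, ha⟩ := ha
  obtain ⟨b, hb1, hbN, hb⟩ := hb
  have key : ∀ d ∈ A, d ≠ (i, j) → ∃ k l, d = (k, l) ∧ k < l ∧ l ≤ N ∧
      ¬ ChainCrosses s i j k l ∧ j - i ≤ l - k ∧ (k ≠ i ∨ l ≠ j) := by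
    rintro ⟨k, l⟩ hd hne
    refine ⟨k, l, rfl, (hA _ hd).1, (hA _ hd).2, hnc _ he _ hd, hmin _ hd, ?_⟩
    by_contra hcon
    exact hne (by ext <;> simp <;> omega)
  -- An end point of the chord counts as below it iff it lies on the upper chain. If neither end
  -- point is extreme and they lie on different chains, they are the two positions. If only one of
  -- them is extreme, or they lie on the same chain, one of them is taken together with `a` or `b`.
  by_cases hi : i = 0
  · by_cases hj : j = N
    · refine ⟨a, b, ⟨ha1, haN, ha⟩, ⟨hb1, hbN, hb⟩, fun d hd hne => ?_⟩
      obtain ⟨k, l, rfl, h⟩ := key d hd hne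
      omega
    · by_cases hs : s j = true
      · refine ⟨j, b, ⟨by omega, by omega, by unfold Below; grind⟩, ⟨hb1, hbN, hb⟩,
        fun d hd hne => ?_⟩
        obtain ⟨k, l, rfl, h⟩ := key d hd hne
        clear key hnc hmin hA he
        unfold Below ChainCrosses at *
        grind (splits := 25)
      · refine ⟨a, j, ⟨ha1, haN, ha⟩, ⟨by omega, by omega, by unfold Below; grind⟩,
        fun d hd hne => ?_⟩
        obtain ⟨k, l, rfl, h⟩ := key d hd hne
        clear key hnc hmin hA he
        unfold Below ChainCrosses at *
        grind (splits := 25)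
  · by_cases hj : j = N
    · by_cases hs : s i = true
      · refine ⟨i, b, ⟨by omega, by omega, by unfold Below; grind⟩, ⟨hb1, hbN, hb⟩,
        fun d hd hne => ?_⟩
        obtain ⟨k, l, rfl, h⟩ := key d hd hne
        clear key hnc hmin hA he
        unfold Below ChainCrosses at *
        grind (splits := 25)
      · refine ⟨a, i, ⟨ha1, haN, ha⟩, ⟨by omega, by omega, by unfold Below; grind⟩,
        fun d hd hne => ?_⟩
        obtain ⟨k, l, rfl, h⟩ := key d hd hne
        clear key hnc hmin hA he
        unfold Below ChainCrosses at *
        grind (splits := 25)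
    · cases hsi : s i <;> cases hsj : s j
      · by_cases hl : ∃ l, j < l ∧ (i, l) ∈ A
        · -- The chord `il'` separates `i` from `a`, but no chord `kj` of the set with `k < i`
          -- separates `j` from `a`, since it would cross `il'`.
          obtain ⟨l', hl', hlA⟩ := hl
          refine ⟨a, j, ⟨ha1, haN, ha⟩, ⟨by omega, by omega, by unfold Below; grind⟩,
            fun d hd hne => ?_⟩
          have := hnc _ hlA _ hd
          obtain ⟨k, l, rfl, h⟩ := key d hd hne
          clear key hnc hmin hA he
          unfold Below ChainCrosses at *
          grind (splits := 25)
        · refine ⟨a, i, ⟨ha1, haN, ha⟩, ⟨by omega, by omega, by unfold Below; grind⟩,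
          fun d hd hne => ?_⟩
          obtain ⟨k, l, rfl, h⟩ := key d hd hne
          have : ¬ (j < l ∧ k = i) := fun h => hl ⟨l, h.1, h.2 ▸ hd⟩
          clear key hnc hmin hA he
          unfold Below ChainCrosses at *
          grind (splits := 25)
      · refine ⟨j, i, ⟨by omega, by omega, by unfold Below; grind⟩,
        ⟨by omega, by omega, by unfold Below; grind⟩,
        fun d hd hne => ?_⟩
        obtain ⟨k, l, rfl, h⟩ := key d hd hne
        clear key hnc hmin hA he
        unfold Below ChainCrosses at *
        grind (splits := 25)
      · refine ⟨i, j, ⟨by omega, by omega, by unfold Below; grind⟩,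
        ⟨by omega, by omega, by unfold Below; grind⟩,
        fun d hd hne => ?_⟩
        obtain ⟨k, l, rfl, h⟩ := key d hd hne
        clear key hnc hmin hA he
        unfold Below ChainCrosses at *
        grind (splits := 25)
      · by_cases hl : ∃ l, j < l ∧ (i, l) ∈ A
        · obtain ⟨l', hl', hlA⟩ := hl
          refine ⟨j, b, ⟨by omega, by omega, by unfold Below; grind⟩, ⟨hb1, hbN, hb⟩,
            fun d hd hne => ?_⟩
          have := hnc _ hlA _ hd
          obtain ⟨k, l, rfl, h⟩ := key d hd hne
          clear key hnc hmin hA he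
          unfold Below ChainCrosses at *
          grind (splits := 25)
        · refine ⟨i, b, ⟨by omega, by omega, by unfold Below; grind⟩, ⟨hb1, hbN, hb⟩,
          fun d hd hne => ?_⟩
          obtain ⟨k, l, rfl, h⟩ := key d hd hne
          have : ¬ (j < l ∧ k = i) := fun h => hl ⟨l, h.1, h.2 ▸ hd⟩
          clear key hnc hmin hA he
          unfold Below ChainCrosses at *
          grind (splits := 25)

/-! ### The polytope of a polygon with an upper and a lower chain -/

section ChainPolytope

open Classical in
/-- The set `S_{ij}` of the coordinates that count as below the chord `ij`; the index `m` stands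
for the position `m + 1`. -/
noncomputable def belowSet (n : ℕ) (s : ℕ → Bool) (i j : ℕ) : Finset (Fin (n + 1)) :=
  Finset.univ.filter fun m => Below s i j (m + 1)

theorem mem_belowSet {n : ℕ} {s : ℕ → Bool} {i j : ℕ} {m : Fin (n + 1)} :
    m ∈ belowSet n s i j ↔ Below s i j (m + 1) := by
  simp [belowSet]

/-- The polytope cut out by the inequalities of all chords `ij` of a polygon with `n + 3` vertices
and signs `s`. Chords that are edges of the polygon are not excluded: the inequality of an edge is
trivial. -/
def chainPolytope (n : ℕ) (s : ℕ → Bool) : Set (Fin (n + 1) → ℝ) :=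
  {x | (∀ i j, i < j → j ≤ n + 2 →
      ((belowSet n s i j).card : ℝ) * ((belowSet n s i j).card + 1) / 2
        ≤ ∑ m ∈ belowSet n s i j, x m) ∧
    ∑ m, x m = ((n : ℝ) + 1) * (n + 2) / 2}

/-- The chords of the polygon that have a nonempty and proper set of coordinates below them. These
are its internal diagonals. -/
abbrev InnerPair (n : ℕ) (s : ℕ → Bool) : Type :=
  {d : Fin (n + 3) × Fin (n + 3) // d.1 < d.2 ∧
    (belowSet n s d.1 d.2).Nonempty ∧ belowSet n s d.1 d.2 ≠ Finset.univ}

/-- The set of coordinates below an inner pair. -/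
noncomputable abbrev InnerPair.below {n : ℕ} {s : ℕ → Bool} (d : InnerPair n s) :
    Finset (Fin (n + 1)) :=
  belowSet n s d.1.1 d.1.2

/-- Crossing of inner pairs. -/
def InnerPair.Crosses {n : ℕ} {s : ℕ → Bool} (d e : InnerPair n s) : Prop :=
  ChainCrosses s d.1.1 d.1.2 e.1.1 e.1.2

/-- The outer normal functional `x ↦ -∑_{m ∈ S} x m`. -/
def negSum {n : ℕ} (S : Finset (Fin (n + 1))) : Module.Dual ℝ (Fin (n + 1) → ℝ) :=
  -∑ m ∈ S, LinearMap.proj m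

theorem negSum_apply {n : ℕ} (S : Finset (Fin (n + 1))) (x : Fin (n + 1) → ℝ) :
    negSum S x = -∑ m ∈ S, x m := by
  simp [negSum, LinearMap.sum_apply]

theorem single_sub_single_mem_rootSpace {n : ℕ} (a b : Fin (n + 1)) :
    (Pi.single a 1 - Pi.single b 1 : Fin (n + 1) → ℝ) ∈ rootSpace n := by
  change ∑ m, (Pi.single a 1 - Pi.single b 1 : Fin (n + 1) → ℝ) m = 0
  simp [Finset.sum_sub_distrib]

theorem negSum_single_sub_single {n : ℕ} (S : Finset (Fin (n + 1))) (a b : Fin (n + 1)) :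
    negSum S (Pi.single a 1 - Pi.single b 1) =
      (if b ∈ S then 1 else 0) - (if a ∈ S then 1 else 0) := by
  rw [negSum_apply]
  simp [Finset.sum_sub_distrib, Pi.single_apply]

/-- The center of the permutahedron, which satisfies the inequalities of all inner pairs strictly.
-/
noncomputable def centerPoint (n : ℕ) : Fin (n + 1) → ℝ := fun _ => ((n : ℝ) + 2) / 2

variable {n : ℕ} {s : ℕ → Bool}

theorem InnerPair.card_lt (d : InnerPair n s) : d.below.card < n + 1 := by
  have := (Finset.card_lt_iff_ne_univ d.below).mpr d.2.2.2
  simpa using this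

theorem negSum_centerPoint_lt (d : InnerPair n s) :
    negSum d.below (centerPoint n) < -((d.below.card : ℝ) * (d.below.card + 1) / 2) := by
  have h1 : (0 : ℝ) < d.below.card := by exact_mod_cast d.2.2.1.card_pos
  have h2 : (d.below.card : ℝ) < n + 1 := by exact_mod_cast d.card_lt
  rw [negSum_apply]
  simp only [centerPoint, Finset.sum_const, nsmul_eq_mul]
  nlinarith

theorem mem_chainPolytope_iff (x : Fin (n + 1) → ℝ) :
    x ∈ chainPolytope n s ↔ x - centerPoint n ∈ rootSpace n ∧ ∀ d : InnerPair n s,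
      negSum d.below x ≤ -((d.below.card : ℝ) * (d.below.card + 1) / 2) := by
  have hsum : x - centerPoint n ∈ rootSpace n ↔ ∑ m, x m = ((n : ℝ) + 1) * (n + 2) / 2 := by
    change ∑ m, (x - centerPoint n) m = 0 ↔ _
    simp only [Pi.sub_apply, Finset.sum_sub_distrib, centerPoint, Finset.sum_const,
      Finset.card_univ, Fintype.card_fin, nsmul_eq_mul, sub_eq_zero]
    push_cast
    rw [mul_div_assoc]
  rw [hsum]
  constructor
  · rintro ⟨h1, h2⟩
    refine ⟨h2, fun d => ?_⟩
    rw [negSum_apply]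
    exact neg_le_neg (h1 _ _ d.2.1 (by omega))
  · rintro ⟨h2, h1⟩
    refine ⟨fun i j hij hj => ?_, h2⟩
    by_cases hne : (belowSet n s i j).Nonempty
    · by_cases hu : belowSet n s i j = Finset.univ
      · rw [hu, h2]; simp; apply le_of_eq; ring
      · have := h1 ⟨(⟨i, by omega⟩, ⟨j, by omega⟩), hij, hne, hu⟩
        rw [negSum_apply] at this
        exact neg_le_neg_iff.mp this
    · rw [Finset.not_nonempty_iff_eq_empty.mp hne]; simp

theorem centerPoint_mem : centerPoint n ∈ chainPolytope n s := by
  rw [mem_chainPolytope_iff, sub_self]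
  exact ⟨Submodule.zero_mem _, fun d => (negSum_centerPoint_lt d).le⟩

theorem vectorSpan_chainPolytope : vectorSpan ℝ (chainPolytope n s) = rootSpace n := by
  apply le_antisymm
  · rw [vectorSpan_def, Submodule.span_le]
    rintro _ ⟨x, hx, y, hy, rfl⟩
    have := (rootSpace n).sub_mem ((mem_chainPolytope_iff x).mp hx).1
      ((mem_chainPolytope_iff y).mp hy).1
    rwa [sub_sub_sub_cancel_right] at this
  · intro w hw
    obtain ⟨ε, hε, hm⟩ := exists_small_move (fun d : InnerPair n s => negSum d.below) _
      (x := centerPoint n) (w := w) (fun d => (negSum_centerPoint_lt d).le)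
      (fun d hd => absurd hd (negSum_centerPoint_lt d).ne)
    have hz : centerPoint n + ε • w ∈ chainPolytope n s := by
      rw [mem_chainPolytope_iff, add_sub_cancel_left]
      exact ⟨Submodule.smul_mem _ _ hw, fun d => (hm d).1⟩
    have := vsub_mem_vectorSpan ℝ hz (centerPoint_mem (n := n) (s := s))
    rw [vsub_eq_sub, add_sub_cancel_left] at this
    exact (Submodule.smul_mem_iff _ hε.ne').mp this

/-- The normal of an inner pair, as a functional on the direction space of the polytope. -/
noncomputable def innerNormal (d : InnerPair n s) :
    Module.Dual ℝ (vectorSpan ℝ (chainPolytope n s)) :=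
  (negSum d.below).comp (vectorSpan ℝ (chainPolytope n s)).subtype

/-- The vector `e_a - e_b` in the direction space of the polytope. -/
def rootVector (a b : Fin (n + 1)) : vectorSpan ℝ (chainPolytope n s) :=
  ⟨Pi.single a 1 - Pi.single b 1, by
    rw [vectorSpan_chainPolytope]; exact single_sub_single_mem_rootSpace a b⟩

open Classical in
theorem innerNormal_rootVector (d : InnerPair n s) (a b : Fin (n + 1)) :
    innerNormal d (rootVector a b) =
      (if Below s d.1.1 d.1.2 (b + 1) then 1 else 0) -
        (if Below s d.1.1 d.1.2 (a + 1) then 1 else 0) := by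
  simp only [innerNormal, rootVector, LinearMap.comp_apply, Submodule.subtype_apply,
    negSum_single_sub_single, mem_belowSet]

/-- Two inner pairs whose inequalities are tight at a common point do not cross: otherwise the
intersection and the union of their coordinate sets belong to two further chords, and one of their
inequalities would be violated since `k ↦ k (k + 1) / 2` is strictly convex. -/
theorem not_crosses_of_tight {x : Fin (n + 1) → ℝ} (hx : x ∈ chainPolytope n s)
    (d e : InnerPair n s)
    (hd : negSum d.below x = -((d.below.card : ℝ) * (d.below.card + 1) / 2))
    (he : negSum e.below x = -((e.below.card : ℝ) * (e.below.card + 1) / 2)) :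
    ¬ d.Crosses e := by
  intro hc
  rw [negSum_apply, neg_inj] at hd he
  obtain ⟨a, b, -, -, -, -, -, -, -, -, ha1, ha2, hb1, hb2, had, hae, hbe, hbd⟩ :=
    ChainCrosses.exists_separated hc
  have hN1 := d.1.2.2
  have hN2 := e.1.2.2
  have ha : (⟨a - 1, by omega⟩ : Fin (n + 1)) ∈ d.below \ e.below := by
    simp only [Finset.mem_sdiff, mem_belowSet]
    rw [Nat.sub_add_cancel (by omega)]; exact ⟨had, hae⟩
  have hb : (⟨b - 1, by omega⟩ : Fin (n + 1)) ∈ e.below \ d.below := by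
    simp only [Finset.mem_sdiff, mem_belowSet]
    rw [Nat.sub_add_cancel (by omega)]; exact ⟨hbe, hbd⟩
  obtain ⟨i, j, i', j', hij, hj, hij', hj', hI, hU⟩ := exists_inter_union hc
    (N := n + 2) (by omega) (by omega)
  have hI' : belowSet n s i j = d.below ∩ e.below := by
    ext m; simp only [Finset.mem_inter, mem_belowSet, hI]
  have hU' : belowSet n s i' j' = d.below ∪ e.below := by
    ext m; simp only [Finset.mem_union, mem_belowSet, hU]
  have h1 := hx.1 i j hij hj
  have h2 := hx.1 i' j' hij' hj'
  rw [hI'] at h1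
  rw [hU'] at h2
  have h3 := Finset.sum_union_inter (s₁ := d.below) (s₂ := e.below) (f := x)
  have c1 := Finset.card_inter_add_card_sdiff d.below e.below
  have c2 := Finset.card_inter_add_card_sdiff e.below d.below
  have c3 := Finset.card_union_add_card_inter d.below e.below
  rw [Finset.inter_comm] at c2
  have p1 := Finset.card_pos.mpr ⟨_, ha⟩
  have p2 := Finset.card_pos.mpr ⟨_, hb⟩
  have c1' : ((d.below ∩ e.below).card : ℝ) + (d.below \ e.below).card = d.below.card := by
    exact_mod_cast c1
  have c2' : ((d.below ∩ e.below).card : ℝ) + (e.below \ d.below).card = e.below.card := by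
    exact_mod_cast c2
  have c3' : ((d.below ∪ e.below).card : ℝ) + (d.below ∩ e.below).card
      = d.below.card + e.below.card := by exact_mod_cast c3
  have p1' : (0 : ℝ) < (d.below \ e.below).card := by exact_mod_cast p1
  have p2' : (0 : ℝ) < (e.below \ d.below).card := by exact_mod_cast p2
  have c4 : ((d.below ∪ e.below).card : ℝ) = (d.below ∩ e.below).card +
      (d.below \ e.below).card + (e.below \ d.below).card := by linarith
  have h4 : ∑ m ∈ d.below ∪ e.below, x m + ∑ m ∈ d.below ∩ e.below, x m =
      ∑ m ∈ d.below, x m + ∑ m ∈ e.below, x m := h3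
  rw [hd, he, ← c1', ← c2'] at h4
  rw [c4] at h2
  have h5 := mul_pos p1' p2'
  ring_nf at h1 h2 h4 h5
  linarith

/-- The normals of pairwise non-crossing inner pairs are linearly independent. -/
theorem eq_zero_of_sum_innerNormal (g : InnerPair n s → ℝ)
    (hg : ∀ d e, g d ≠ 0 → g e ≠ 0 → ¬ d.Crosses e)
    (h0 : ∑ d, g d • innerNormal d = 0) : g = 0 := by
  classical
  by_contra hne
  obtain ⟨d₀, hd₀⟩ : ∃ d, g d ≠ 0 := by
    by_contra hc; push Not at hc; exact hne (funext hc)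
  -- test the relation on a vector that only sees a shortest pair in its support
  obtain ⟨e, he, hmin⟩ := Finset.exists_min_image (Finset.univ.filter fun d => g d ≠ 0)
    (fun d => (d.1.2 : ℕ) - d.1.1) ⟨d₀, by simpa using hd₀⟩
  simp only [Finset.mem_filter, Finset.mem_univ, true_and] at he hmin
  obtain ⟨a, ha⟩ := e.2.2.1
  obtain ⟨b, hb⟩ : ∃ b, b ∉ e.below := by
    by_contra hc; push Not at hc; exact e.2.2.2 (Finset.eq_univ_iff_forall.mpr hc)
  rw [mem_belowSet] at ha hb
  obtain ⟨a, b, ⟨ha1, ha2, ha⟩, ⟨hb1, hb2, hb⟩, hab⟩ :=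
    exists_separated_only_by_shortest (s := s) (N := n + 2)
    (A := (fun d : InnerPair n s => ((d.1.1 : ℕ), (d.1.2 : ℕ))) '' {d | g d ≠ 0})
    (i := e.1.1) (j := e.1.2)
    (by rintro _ ⟨d, -, rfl⟩; exact ⟨d.2.1, by simp; omega⟩)
    (by rintro _ ⟨d, hd, rfl⟩ _ ⟨d', hd', rfl⟩; exact hg d d' hd hd')
    ⟨e, he, rfl⟩ (by rintro _ ⟨d, hd, rfl⟩; exact hmin d hd)
    ⟨a + 1, by omega, by omega, ha⟩ ⟨b + 1, by omega, by omega, hb⟩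
  have h1 := LinearMap.congr_fun h0 (rootVector ⟨b - 1, by omega⟩ ⟨a - 1, by omega⟩)
  rw [LinearMap.sum_apply, Finset.sum_eq_single e] at h1
  · rw [LinearMap.smul_apply, innerNormal_rootVector] at h1
    simp only [Nat.sub_add_cancel ha1, Nat.sub_add_cancel hb1, if_pos ha, if_neg hb] at h1
    simp at h1
    exact he h1
  · intro d _ hd
    rw [LinearMap.smul_apply, innerNormal_rootVector]
    simp only [Nat.sub_add_cancel ha1, Nat.sub_add_cancel hb1]
    by_cases hgd : g d = 0
    · simp [hgd]
    · have := hab _ ⟨d, hgd, rfl⟩ (fun h => hd (by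
        simp only [Prod.mk.injEq] at h
        exact Subtype.ext (Prod.ext (Fin.ext h.1) (Fin.ext h.2))))
      simp only at this
      simp [this]
  · simp

/-- For each pair that occurs in a nonnegative combination of normals of non-crossing inner pairs,
the combination separates any two positions in the range of the pair in the same way as the pair.
-/
theorem sum_innerNormal_rootVector_pos (f : InnerPair n s → ℝ) (hf : ∀ d, 0 ≤ f d)
    (hfc : ∀ d e, f d ≠ 0 → f e ≠ 0 → ¬ d.Crosses e) (d : InnerPair n s) (hd : f d ≠ 0)
    {a b : ℕ} (ha1 : 1 ≤ a) (ha2 : a ≤ n + 1) (hb1 : 1 ≤ b) (hb2 : b ≤ n + 1)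
    (ha : d.1.1 ≤ a ∧ a ≤ d.1.2) (hb : d.1.1 ≤ b ∧ b ≤ d.1.2)
    (had : Below s d.1.1 d.1.2 a) (hbd : ¬ Below s d.1.1 d.1.2 b) :
    0 < (∑ e, f e • innerNormal e) (rootVector ⟨b - 1, by omega⟩ ⟨a - 1, by omega⟩) := by
  classical
  rw [LinearMap.sum_apply]
  have hterm : ∀ e, (f e • innerNormal e) (rootVector ⟨b - 1, by omega⟩ ⟨a - 1, by omega⟩) =
      f e * ((if Below s e.1.1 e.1.2 a then 1 else 0) -
        (if Below s e.1.1 e.1.2 b then 1 else 0)) := fun e => by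
    rw [LinearMap.smul_apply, innerNormal_rootVector]
    simp only [Nat.sub_add_cancel ha1, Nat.sub_add_cancel hb1, smul_eq_mul]
  refine Finset.sum_pos' (fun e _ => ?_) ⟨d, Finset.mem_univ _, ?_⟩
  · rw [hterm]
    by_cases he : f e = 0
    · simp [he]
    · refine mul_nonneg (hf e) ?_
      by_cases hbe : Below s e.1.1 e.1.2 b
      · rw [if_pos hbe, if_pos (below_of_not_chainCrosses d.2.1 e.2.1 (hfc d e hd he)
          ha.1 ha.2 hb.1 hb.2 had hbd hbe)]
        simp
      · rw [if_neg hbe, sub_zero]; split_ifs <;> norm_num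
  · rw [hterm, if_pos had, if_neg hbd]
    simpa using lt_of_le_of_ne (hf d) (Ne.symm hd)

/-- If two nonnegative combinations of normals of non-crossing inner pairs agree, the pairs of one
do not cross those of the other: two crossing pairs separate some two positions in opposite ways,
so the combinations would have opposite signs on the corresponding vector `e_b - e_a`. -/
theorem not_crosses_of_sum_eq (f g : InnerPair n s → ℝ) (hf : ∀ d, 0 ≤ f d) (hg : ∀ d, 0 ≤ g d)
    (hfc : ∀ d e, f d ≠ 0 → f e ≠ 0 → ¬ d.Crosses e)
    (hgc : ∀ d e, g d ≠ 0 → g e ≠ 0 → ¬ d.Crosses e)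
    (hfg : ∑ d, f d • innerNormal d = ∑ d, g d • innerNormal d) (d e : InnerPair n s)
    (hd : f d ≠ 0) (he : g e ≠ 0) : ¬ d.Crosses e := by
  intro hc
  obtain ⟨a, b, h1, h2, h3, h4, h5, h6, h7, h8, ha1, ha2, hb1, hb2, had, hae, hbe, hbd⟩ :=
    ChainCrosses.exists_separated hc
  have hN1 := d.1.2.2
  have hN2 := e.1.2.2
  have p1 := sum_innerNormal_rootVector_pos f hf hfc d hd (a := a) (b := b) (by omega) (by omega)
    (by omega) (by omega) ⟨h1, h2⟩ ⟨h5, h6⟩ had hbd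
  have p2 := sum_innerNormal_rootVector_pos g hg hgc e he (a := b) (b := a) (by omega) (by omega)
    (by omega) (by omega) ⟨h7, h8⟩ ⟨h3, h4⟩ hbe hae
  rw [hfg] at p1
  have hneg : rootVector (s := s) (⟨b - 1, by omega⟩ : Fin (n + 1)) ⟨a - 1, by omega⟩ =
      -rootVector ⟨a - 1, by omega⟩ ⟨b - 1, by omega⟩ := by
    ext; simp [rootVector]
  rw [hneg, map_neg] at p1
  linarith

end ChainPolytope

/-! ### Compactness and the normal fan of the polytope -/

section ChainFan

variable {n : ℕ} {s : ℕ → Bool}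

theorem exists_last_le (p : ℕ → Prop) {i k : ℕ} (hik : i ≤ k) (hi : p i) :
    ∃ i', i' ≤ k ∧ p i' ∧ ∀ m, i' < m → m ≤ k → ¬ p m := by
  classical
  exact ⟨Nat.findGreatest p k, Nat.findGreatest_le k, Nat.findGreatest_spec hik hi,
    fun m h1 h2 => Nat.findGreatest_is_greatest h1 h2⟩

theorem exists_first_gt (p : ℕ → Prop) {j k : ℕ} (hkj : k < j) (hj : p j) :
    ∃ j', k < j' ∧ j' ≤ j ∧ p j' ∧ ∀ m, k < m → m < j' → ¬ p m := by
  classical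
  have h : ∃ m, k < m ∧ p m := ⟨j, hkj, hj⟩
  exact ⟨Nat.find h, (Nat.find_spec h).1, Nat.find_min' h ⟨hkj, hj⟩, (Nat.find_spec h).2,
    fun m h1 h2 hm => Nat.find_min h h2 ⟨h1, hm⟩⟩

/-- Initial segments of the positions are cut off by chords: from the last upper vertex up to `k`
to the first lower vertex after `k`. -/
theorem exists_below_initial (hs0 : s 0 ≠ s 1) (hsn : s (n + 1) ≠ s (n + 2)) {k : ℕ} (hk1 : 1 ≤ k)
    (hkn : k ≤ n) : ∃ i j, i < j ∧ j ≤ n + 2 ∧ ∀ m, Below s i j m ↔ m ≤ k := by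
  obtain ⟨i₀, hi₀, hsi₀⟩ : ∃ i, i ≤ k ∧ s i = true := by
    cases h : s 0
    · exact ⟨1, hk1, by cases h' : s 1 <;> simp_all⟩
    · exact ⟨0, by omega, h⟩
  obtain ⟨j₀, hj₀, hjn, hsj₀⟩ : ∃ j, k < j ∧ j ≤ n + 2 ∧ s j = false := by
    cases h : s (n + 1)
    · exact ⟨n + 1, by omega, by omega, h⟩
    · exact ⟨n + 2, by omega, by omega, by cases h' : s (n + 2) <;> simp_all⟩
  obtain ⟨i, hik, hsi, hi⟩ := exists_last_le (fun m => s m = true) hi₀ hsi₀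
  obtain ⟨j, hkj, hjj, hsj, hj⟩ := exists_first_gt (fun m => s m = false) hj₀ hsj₀
  refine ⟨i, j, by omega, by omega, fun m => ?_⟩
  unfold Below
  grind

/-- Final segments of the positions are cut off by chords, since exchanging the chains complements
the sets below the chords. -/
theorem exists_below_final (hs0 : s 0 ≠ s 1) (hsn : s (n + 1) ≠ s (n + 2)) {k : ℕ} (hk1 : 1 ≤ k)
    (hkn : k ≤ n) : ∃ i j, i < j ∧ j ≤ n + 2 ∧ ∀ m, Below s i j m ↔ k < m := by
  obtain ⟨i, j, hij, hj, h⟩ := exists_below_initial (s := fun m => !s m) (n := n) (k := k)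
    (by simpa using hs0) (by simpa using hsn) hk1 hkn
  refine ⟨i, j, hij, hj, fun m => ?_⟩
  rw [← not_le, ← h m]
  unfold Below
  grind

/-- The inequalities of the initial and the final segments bound the partial sums of the
coordinates, hence the coordinates. -/
theorem isCompact_chainPolytope (hs0 : s 0 ≠ s 1) (hsn : s (n + 1) ≠ s (n + 2)) :
    IsCompact (chainPolytope n s) := by
  classical
  have hclosed : IsClosed (chainPolytope n s) := by
    have : chainPolytope n s = (⋂ i, ⋂ j, ⋂ (_ : i < j), ⋂ (_ : j ≤ n + 2),
        {x | ((belowSet n s i j).card : ℝ) * ((belowSet n s i j).card + 1) / 2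
          ≤ ∑ m ∈ belowSet n s i j, x m}) ∩ {x | ∑ m, x m = ((n : ℝ) + 1) * (n + 2) / 2} := by
      ext x; simp [chainPolytope]
    rw [this]
    refine IsClosed.inter ?_ (isClosed_eq (by fun_prop) continuous_const)
    exact isClosed_iInter fun i => isClosed_iInter fun j => isClosed_iInter fun _ =>
      isClosed_iInter fun _ => isClosed_le continuous_const (by fun_prop)
  -- all partial sums lie between `0` and the total sum
  set B : ℝ := ((n : ℝ) + 1) * (n + 2) / 2 with hB
  have hpart : ∀ x ∈ chainPolytope n s, ∀ k ≤ n + 1,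
      0 ≤ ∑ m : Fin (n + 1) with m.val + 1 ≤ k, x m ∧
        ∑ m : Fin (n + 1) with m.val + 1 ≤ k, x m ≤ B := by
    intro x hx k hk
    have hB0 : 0 ≤ B := by positivity
    rcases Nat.eq_zero_or_pos k with rfl | hk1
    · simpa using hB0
    rcases Nat.eq_or_lt_of_le hk with rfl | hkn
    · have : (Finset.univ.filter fun m : Fin (n + 1) => m.val + 1 ≤ n + 1) = Finset.univ := by
        ext m; simp; omega
      rw [this, hx.2]
      exact ⟨hB0, le_rfl⟩
    · obtain ⟨i, j, hij, hj, h⟩ := exists_below_initial hs0 hsn hk1 (Nat.lt_succ_iff.mp hkn)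
      obtain ⟨i', j', hij', hj', h'⟩ := exists_below_final hs0 hsn hk1 (Nat.lt_succ_iff.mp hkn)
      have e1 : belowSet n s i j = Finset.univ.filter fun m : Fin (n + 1) => m.val + 1 ≤ k := by
        ext m; simp [mem_belowSet, h]
      have e2 : belowSet n s i' j' =
          Finset.univ.filter fun m : Fin (n + 1) => ¬ (m.val + 1 ≤ k) := by
        ext m; simp [mem_belowSet, h']
      have h1 := hx.1 i j hij hj
      have h2 := hx.1 i' j' hij' hj'
      rw [e1] at h1
      rw [e2] at h2
      have h3 := Finset.sum_filter_add_sum_filter_not Finset.univ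
        (fun m : Fin (n + 1) => m.val + 1 ≤ k) x
      rw [hx.2] at h3
      refine ⟨le_trans (by positivity) h1, ?_⟩
      have : (0 : ℝ) ≤ ∑ m : Fin (n + 1) with ¬ (m.val + 1 ≤ k), x m :=
        le_trans (by positivity) h2
      linarith
  refine (isCompact_Icc (a := fun _ : Fin (n + 1) => -B) (b := fun _ => B)).of_isClosed_subset
    hclosed fun x hx => ?_
  have hx' : ∀ m, -B ≤ x m ∧ x m ≤ B := by
    intro m
    obtain ⟨h1, h2⟩ := hpart x hx m.val (by omega)
    obtain ⟨h3, h4⟩ := hpart x hx (m.val + 1) (by omega)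
    have hins : (Finset.univ.filter fun i : Fin (n + 1) => i.val + 1 ≤ m.val + 1) =
        insert m (Finset.univ.filter fun i : Fin (n + 1) => i.val + 1 ≤ m.val) := by
      ext i; simp [Fin.ext_iff]; omega
    rw [hins, Finset.sum_insert (by simp)] at h3 h4
    constructor <;> linarith
  exact ⟨fun m => (hx' m).1, fun m => (hx' m).2⟩

theorem isPolytope_chainPolytope (hs0 : s 0 ≠ s 1) (hsn : s (n + 1) ≠ s (n + 2)) :
    IsPolytope (chainPolytope n s) :=
  isPolytope_of_isCompact _ _ mem_chainPolytope_iff (isCompact_chainPolytope hs0 hsn)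

theorem normalFan_chainPolytope (hs0 : s 0 ≠ s 1) (hsn : s (n + 1) ≠ s (n + 2)) :
    normalFan (chainPolytope n s) = compatibleFan InnerPair.Crosses innerNormal :=
  normalFan_eq_compatibleFan InnerPair.Crosses (fun d : InnerPair n s => negSum d.below) _
    (by rw [vectorSpan_chainPolytope]; exact mem_chainPolytope_iff)
    (isCompact_chainPolytope hs0 hsn) ⟨_, centerPoint_mem⟩
    (fun _ hx d e hd he => not_crosses_of_tight hx d e hd he)
    eq_zero_of_sum_innerNormal not_crosses_of_sum_eq

end ChainFan

/-! ### Hohlweg–Lange associahedra -/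

section HohlwegLange

/-- The signs of the polygon vertices as a function on the natural numbers, with the value `false`
beyond the last vertex. -/
def hlSign (n : ℕ) (σ : Fin (n - 1) → Bool) (k : ℕ) : Bool :=
  if h : k < n + 3 then vertexSign n σ ⟨k, h⟩ else false

theorem hlSign_val {n : ℕ} {σ : Fin (n - 1) → Bool} (k : Fin (n + 3)) :
    hlSign n σ k = vertexSign n σ k := by
  simp [hlSign]

theorem hlSign_interior {n : ℕ} {σ : Fin (n - 1) → Bool} {k : ℕ} (h2 : 2 ≤ k) (hn : k ≤ n) :
    hlSign n σ k = σ ⟨k - 2, by omega⟩ := by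
  simp only [hlSign, vertexSign, dif_pos (show k < n + 3 by omega), dif_pos (And.intro h2 hn)]

theorem hlSign_left {n : ℕ} (σ : Fin (n - 1) → Bool) :
    hlSign n σ 0 ≠ hlSign n σ 1 := by
  simp [hlSign, vertexSign]

theorem hlSign_right {n : ℕ} (σ : Fin (n - 1) → Bool) :
    hlSign n σ (n + 1) ≠ hlSign n σ (n + 2) := by
  simp [hlSign, vertexSign]

theorem mem_hlIndexSet {n : ℕ} {σ : Fin (n - 1) → Bool} {i j : Fin (n + 3)} (hij : i < j)
    (m : Fin (n + 1)) :
    m ∈ hlIndexSet n σ i j ↔ Below (hlSign n σ) i j (m + 1) := by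
  have hm : (m.succ.castSucc : Fin (n + 3)).val = m + 1 := rfl
  simp only [hlIndexSet, Finset.mem_filter, Finset.mem_univ, true_and, hlSet, Set.mem_image,
    verticesBelow, Set.mem_ofPred_eq, ← hlSign_val, Fin.lt_def, Fin.ext_iff]
  constructor
  · rintro ⟨k, hk, hkm⟩
    unfold Below
    split_ifs at hkm <;> grind
  · intro h
    -- the end points of the chord come from the vertices `0` and `n + 2`
    by_cases h1 : m.val + 1 = i.val
    · refine ⟨⟨0, by omega⟩, ?_, ?_⟩ <;> unfold Below at h <;> grind
    · by_cases h2 : m.val + 1 = j.val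
      · refine ⟨⟨n + 2, by omega⟩, ?_, ?_⟩ <;> unfold Below at h <;> grind
      · refine ⟨m.succ.castSucc, ?_, ?_⟩ <;> unfold Below at h <;> grind

theorem hohlwegLange_eq_chainPolytope (n : ℕ) (σ : Fin (n - 1) → Bool) :
    hohlwegLange n σ = chainPolytope n (hlSign n σ) := by
  have hset : ∀ i j : Fin (n + 3), i < j → hlIndexSet n σ i j = belowSet n (hlSign n σ) i j :=
    fun i j hij => by ext m; rw [mem_hlIndexSet hij, mem_belowSet]
  ext x
  constructor
  · rintro ⟨h1, h2⟩
    refine ⟨fun i j hij hj => ?_, h2⟩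
    have hlt : (⟨i, by omega⟩ : Fin (n + 3)) < ⟨j, by omega⟩ := hij
    by_cases hd : IsHLDiagonal n σ ⟨i, by omega⟩ ⟨j, by omega⟩
    · have := h1 _ _ hd
      rwa [hset _ _ hlt] at this
    · rcases not_and_or.mp (fun h => hd ⟨hlt, h⟩) with h | h
      · -- nothing lies below the chord
        have hempty : belowSet n (hlSign n σ) i j = ∅ := by
          rw [← hset _ _ hlt]
          ext m
          simp [hlIndexSet, hlSet, Set.not_nonempty_iff_eq_empty.mp h]
        rw [hempty]; simp
      · -- nothing lies above the chord, so all coordinates are below or on it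
        have huniv : belowSet n (hlSign n σ) i j = Finset.univ := by
          ext m
          simp only [mem_belowSet, Finset.mem_univ, iff_true]
          by_contra hm
          refine h ?_
          have key : ∀ k : ℕ, k < n + 3 → (i < k ∧ k < j ∧ hlSign n σ k = true) ∨
              (k < i ∧ hlSign n σ i = false) ∨ (j < k ∧ hlSign n σ j = false) →
              (verticesAbove (vertexSign n σ) ⟨i, by omega⟩ ⟨j, by omega⟩).Nonempty := by
            intro k hk hk'
            refine ⟨⟨k, hk⟩, ?_⟩
            simpa only [verticesAbove, Set.mem_ofPred_eq, ← hlSign_val, Fin.lt_def] using hk'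
          by_cases h1 : m.val + 1 = i
          · refine key 0 (by omega) ?_
            unfold Below at hm; grind
          · by_cases h2 : m.val + 1 = j
            · refine key (n + 2) (by omega) ?_
              unfold Below at hm; grind
            · refine key (m + 1) (by omega) ?_
              unfold Below at hm; grind
        rw [huniv, h2]; simp; apply le_of_eq; ring
  · rintro ⟨h1, h2⟩
    refine ⟨fun i j hd => ?_, h2⟩
    rw [hset i j hd.1]
    exact h1 i j hd.1 (by omega)

end HohlwegLange

/-! ### Rays of Hohlweg–Lange and Santos fans -/

section Rays

theorem santosVector_of_mem {n : ℕ} {T : Set (Diagonal n)} {d : Diagonal n} (h : d ∈ T) :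
    santosVector T d = -Pi.single (⟨d, h⟩ : T) 1 := by
  simp [santosVector, h]

theorem santosVector_nonneg {n : ℕ} {T : Set (Diagonal n)} {d : Diagonal n} (h : d ∉ T) (δ : T) :
    0 ≤ santosVector T d δ := by
  classical
  simp only [santosVector, h, dite_false, Finset.sum_apply]
  refine Finset.sum_nonneg fun e _ => ?_
  split_ifs
  · by_cases he : δ = e
    · subst he; simp
    · simp [he]
  · simp

variable {n : ℕ} {s : ℕ → Bool}

theorem InnerPair.not_crosses_self (d : InnerPair n s) : ¬ d.Crosses d := by
  unfold InnerPair.Crosses ChainCrosses; omega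

theorem innerNormal_ne_zero (d : InnerPair n s) : innerNormal d ≠ 0 := by
  classical
  intro h
  have := eq_zero_of_sum_innerNormal (Pi.single d 1) (fun a b ha hb => by
    have h1 : a = d := by by_contra hc; simp [hc] at ha
    have h2 : b = d := by by_contra hc; simp [hc] at hb
    rw [h1, h2]; exact d.not_crosses_self) (by
    refine Finset.sum_eq_zero fun e _ => ?_
    by_cases he : e = d
    · rw [he, h, smul_zero]
    · simp [he])
  have h1 := congrFun this d
  simp at h1

theorem exists_innerPair (p : ℕ → Prop) {i j a b : ℕ} (hij : i < j) (hj : j ≤ n + 2)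
    (h : ∀ m, 1 ≤ m → m ≤ n + 1 → (Below s i j m ↔ p m)) (ha1 : 1 ≤ a) (ha2 : a ≤ n + 1)
    (ha : p a) (hb1 : 1 ≤ b) (hb2 : b ≤ n + 1) (hb : ¬ p b) :
    ∃ d : InnerPair n s, ∀ m, 1 ≤ m → m ≤ n + 1 → (Below s d.1.1 d.1.2 m ↔ p m) := by
  refine ⟨⟨(⟨i, by omega⟩, ⟨j, by omega⟩), hij, ⟨⟨a - 1, by omega⟩, ?_⟩, ?_⟩, h⟩
  · rw [mem_belowSet]
    simpa only [Nat.sub_add_cancel ha1, h a ha1 ha2] using ha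
  · intro hu
    have := (Finset.ext_iff.mp hu ⟨b - 1, by omega⟩).mpr (Finset.mem_univ _)
    rw [mem_belowSet] at this
    simp only [Nat.sub_add_cancel hb1, h b hb1 hb2] at this
    exact hb this

theorem innerNormal_apply (d : InnerPair n s) (w : vectorSpan ℝ (chainPolytope n s)) :
    innerNormal d w = -∑ m ∈ d.below, (w : Fin (n + 1) → ℝ) m := by
  simp only [innerNormal, LinearMap.comp_apply, Submodule.subtype_apply, negSum_apply]

theorem sum_vectorSpan_chainPolytope (w : vectorSpan ℝ (chainPolytope n s)) :
    ∑ m, (w : Fin (n + 1) → ℝ) m = 0 :=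
  vectorSpan_chainPolytope.le w.2

/-- Each single interior position on the lower chain is cut off by a chord, namely by the one
between the lower vertices next to it. At the ends of the polygon, one of the first two and one of
the last two vertices is a lower one. -/
theorem exists_innerPair_below_eq_singleton (hs0 : s 0 ≠ s 1) (hsn : s (n + 1) ≠ s (n + 2)) {k : ℕ}
    (hk2 : 2 ≤ k) (hkn : k ≤ n) (hsk : s k = false) :
    ∃ d : InnerPair n s, d.below = {⟨k - 1, by omega⟩} := by
  obtain ⟨i, hik, hsi, hi⟩ := exists_last_le (fun m => s m = false) (i := if s 0 then 1 else 0)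
    (k := k - 1) (by split_ifs <;> omega) (by grind)
  obtain ⟨j, hkj, hjj, hsj, hj⟩ := exists_first_gt (fun m => s m = false)
    (j := if s (n + 1) then n + 2 else n + 1) (k := k) (by split_ifs <;> omega) (by grind)
  obtain ⟨d, hd⟩ := exists_innerPair (n := n) (s := s) (fun m => m = k) (a := k) (b := 1)
    (i := i) (j := j) (by omega) (by split_ifs at hjj <;> omega)
    (fun m _ _ => by unfold Below; grind) (by omega) (by omega) rfl (by omega) (by omega)
    (by omega)
  refine ⟨d, ?_⟩
  ext m
  rw [Finset.mem_singleton, mem_belowSet, hd _ (by omega) (by omega), Fin.ext_iff]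
  simp only; omega

theorem exists_innerPair_below_eq_compl_singleton (hs0 : s 0 ≠ s 1) (hsn : s (n + 1) ≠ s (n + 2))
    {k : ℕ} (hk2 : 2 ≤ k) (hkn : k ≤ n) (hsk : s k = true) :
    ∃ d : InnerPair n s, d.below = {⟨k - 1, by omega⟩}ᶜ := by
  obtain ⟨i, hik, hsi, hi⟩ := exists_last_le (fun m => s m = true) (i := if s 0 then 0 else 1)
    (k := k - 1) (by split_ifs <;> omega) (by grind)
  obtain ⟨j, hkj, hjj, hsj, hj⟩ := exists_first_gt (fun m => s m = true)
    (j := if s (n + 1) then n + 1 else n + 2) (k := k) (by split_ifs <;> omega) (by grind)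
  obtain ⟨d, hd⟩ := exists_innerPair (n := n) (s := s) (fun m => m ≠ k) (a := 1) (b := k)
    (i := i) (j := j) (by omega) (by split_ifs at hjj <;> omega)
    (fun m _ _ => by unfold Below; grind) (by omega) (by omega) (by omega) (by omega)
    (by omega) (by simp)
  refine ⟨d, ?_⟩
  ext m
  rw [Finset.mem_compl, Finset.mem_singleton, mem_belowSet, hd _ (by omega) (by omega),
    Fin.ext_iff]
  simp only; omega

theorem innerNormal_eq_neg_of_below_eq_compl {d d' : InnerPair n s} (h : d'.below = d.belowᶜ) :
    innerNormal d' = -innerNormal d := by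
  ext w
  have := Finset.sum_add_sum_compl d.below (w : Fin (n + 1) → ℝ)
  rw [sum_vectorSpan_chainPolytope] at this
  rw [LinearMap.neg_apply, innerNormal_apply, innerNormal_apply, h]
  linarith

/-- A combination of two coordinate vectors that lies on a ray of a Santos fan has positive
coefficients. -/
theorem pos_of_single_add_single_eq_smul_santosVector {T : Set (Diagonal n)}
    {δ δ' : T} (hne : δ ≠ δ') {e : Diagonal n} {c x y : ℝ} (hc : 0 < c) (hx : x ≠ 0) (hy : y ≠ 0)
    (he : (Pi.single δ x + Pi.single δ' y : T → ℝ) = c • santosVector T e) : 0 < x ∧ 0 < y := by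
  have h1 := congrFun he δ
  have h2 := congrFun he δ'
  simp only [Pi.add_apply, Pi.single_eq_same, Pi.single_eq_of_ne hne, Pi.single_eq_of_ne hne.symm,
    Pi.smul_apply, smul_eq_mul, add_zero, zero_add] at h1 h2
  by_cases heT : e ∈ T
  · exfalso
    rw [santosVector_of_mem heT] at h1 h2
    by_cases h3 : δ = ⟨e, heT⟩
    · have h4 : δ' ≠ ⟨e, heT⟩ := fun h => hne (h3.trans h.symm)
      rw [Pi.neg_apply, Pi.single_eq_of_ne h4, neg_zero, mul_zero] at h2
      exact hy h2
    · rw [Pi.neg_apply, Pi.single_eq_of_ne h3, neg_zero, mul_zero] at h1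
      exact hx h1
  · have h3 := mul_nonneg hc.le (santosVector_nonneg heT δ)
    have h4 := mul_nonneg hc.le (santosVector_nonneg heT δ')
    rw [← h1] at h3
    rw [← h2] at h4
    exact ⟨lt_of_le_of_ne h3 hx.symm, lt_of_le_of_ne h4 hy.symm⟩

/-- Antipodal rays of a Santos fan lie on coordinate axes. -/
theorem exists_eq_single_of_antipodal {T : Set (Diagonal n)} {y : T → ℝ}
    (hy : y ≠ 0) {e e' : Diagonal n} {c c' : ℝ} (hc : 0 < c) (hc' : 0 < c')
    (he : y = c • santosVector T e) (he' : -y = c' • santosVector T e') :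
    ∃ δ : T, ∃ a : ℝ, a ≠ 0 ∧ y = Pi.single δ a := by
  by_cases heT : e ∈ T
  · refine ⟨⟨e, heT⟩, -c, by linarith, ?_⟩
    rw [he, santosVector_of_mem heT]
    ext δ
    by_cases hδ : δ = ⟨e, heT⟩
    · subst hδ; simp
    · simp [hδ]
  · by_cases heT' : e' ∈ T
    · refine ⟨⟨e', heT'⟩, c', hc'.ne', ?_⟩
      rw [← neg_neg y, he', santosVector_of_mem heT']
      ext δ
      by_cases hδ : δ = ⟨e', heT'⟩
      · subst hδ; simp
      · simp [hδ]
    · exfalso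
      refine hy ?_
      ext δ
      have h1 := congrFun he' δ
      have h2 := congrFun he δ
      simp only [Pi.neg_apply, Pi.smul_apply, smul_eq_mul, Pi.zero_apply] at h1 h2 ⊢
      have h3 := mul_nonneg hc.le (santosVector_nonneg heT δ)
      have h4 := mul_nonneg hc'.le (santosVector_nonneg heT' δ)
      linarith

/-- If the normal fan of a chain polytope is linearly isomorphic to a Santos fan, the signs
alternate. The antipodal pairs of rays given by the initial and the final segments have to go to
the coordinate axes. The ray of `{k}`, or of its complement, is spanned by a difference of two of
these normals, so its image has two nonzero coordinates, which have to be positive. Hence the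
directions of the images along the axes alternate, and they determine the signs. -/
theorem sign_alternates {T : Set (Diagonal n)} (hs0 : s 0 ≠ s 1) (hsn : s (n + 1) ≠ s (n + 2))
    (h : LinearlyIsomorphic (normalFan (chainPolytope n s)) (santosFan T)) {k : ℕ} (hk2 : 2 ≤ k)
    (hkn : k + 1 ≤ n) : s (k + 1) ≠ s k := by
  classical
  obtain ⟨L, hL⟩ := h
  rw [normalFan_chainPolytope hs0 hsn] at hL
  have hray : ∀ d : InnerPair n s, ∃ e : Diagonal n, ∃ c : ℝ, 0 < c ∧
      L (innerNormal d) = c • santosVector T e := fun d =>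
    exists_pos_smul_of_image_compatibleFan (cr' := Crosses) L hL d d.not_crosses_self
      (innerNormal_ne_zero d)
  -- the normals of initial segments go to coordinate axes
  have hseg : ∀ k, 1 ≤ k → k ≤ n → ∃ d : InnerPair n s,
      (∀ m, 1 ≤ m → m ≤ n + 1 → (Below s d.1.1 d.1.2 m ↔ m ≤ k)) ∧
      ∃ δ : T, ∃ a : ℝ, a ≠ 0 ∧ L (innerNormal d) = Pi.single δ a := by
    intro k hk1 hkn
    obtain ⟨i, j, hij, hj, h⟩ := exists_below_initial hs0 hsn hk1 hkn
    obtain ⟨i', j', hij', hj', h'⟩ := exists_below_final hs0 hsn hk1 hkn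
    obtain ⟨d, hd⟩ := exists_innerPair (n := n) (fun m => m ≤ k) (a := 1) (b := n + 1) hij hj
      (fun m _ _ => h m) le_rfl (by omega) hk1 (by omega) le_rfl (by omega)
    obtain ⟨d', hd'⟩ := exists_innerPair (n := n) (fun m => k < m) (a := n + 1) (b := 1) hij' hj'
      (fun m _ _ => h' m) (by omega) le_rfl (by omega) le_rfl (by omega) (by omega)
    obtain ⟨e, c, hc, he⟩ := hray d
    obtain ⟨e', c', hc', he'⟩ := hray d'
    rw [innerNormal_eq_neg_of_below_eq_compl (d := d) (d' := d') (by
      ext m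
      rw [Finset.mem_compl, mem_belowSet, mem_belowSet, hd _ (by omega) (by omega),
        hd' _ (by omega) (by omega), not_le]), map_neg] at he'
    exact ⟨d, hd, exists_eq_single_of_antipodal
      (fun h0 => innerNormal_ne_zero d (L.map_eq_zero_iff.mp h0)) hc hc' he he'⟩
  -- the sign of position `k` determines in which directions along their axes the images of the
  -- normals of `{1, …, k - 1}` and `{1, …, k}` point
  have hstep : ∀ k, 2 ≤ k → k ≤ n → ∀ (D D' : InnerPair n s),
      (∀ m, 1 ≤ m → m ≤ n + 1 → (Below s D'.1.1 D'.1.2 m ↔ m ≤ k - 1)) →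
      (∀ m, 1 ≤ m → m ≤ n + 1 → (Below s D.1.1 D.1.2 m ↔ m ≤ k)) →
      ∀ (δ δ' : T) (a a' : ℝ), a ≠ 0 → a' ≠ 0 → L (innerNormal D) = Pi.single δ a →
      L (innerNormal D') = Pi.single δ' a' →
      (s k = false → a' < 0 ∧ 0 < a) ∧ (s k = true → 0 < a' ∧ a < 0) := by
    intro k hk2 hkn D D' hD0 hD1 δ δ' a a' ha1 ha0 hL1 hL0
    have hne : δ ≠ δ' := by
      intro heq
      -- otherwise the two normals would be proportional, but only one of them sees `e_k - e_{k+1}`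
      have hprop : a' • innerNormal D = a • innerNormal D' := by
        apply L.injective
        rw [map_smul, map_smul, hL1, hL0, heq, ← Pi.single_smul, ← Pi.single_smul, smul_eq_mul,
          smul_eq_mul, mul_comm]
      have := LinearMap.congr_fun hprop (rootVector ⟨k - 1, by omega⟩ ⟨k, by omega⟩)
      rw [LinearMap.smul_apply, LinearMap.smul_apply, innerNormal_rootVector,
        innerNormal_rootVector] at this
      simp only [hD1 (k - 1 + 1) (by omega) (by omega), hD1 (k + 1) (by omega) (by omega),
        hD0 (k - 1 + 1) (by omega) (by omega), hD0 (k + 1) (by omega) (by omega)] at this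
      rw [if_neg (by omega), if_pos (by omega), if_neg (by omega), if_neg (by omega)] at this
      simp at this
      exact ha0 this
    have hdiff : ∀ w, innerNormal D w - innerNormal D' w =
        -(w : Fin (n + 1) → ℝ) ⟨k - 1, by omega⟩ := by
      intro w
      have hins : D.below = insert ⟨k - 1, by omega⟩ D'.below := by
        ext m
        rw [Finset.mem_insert, mem_belowSet, mem_belowSet, hD1 _ (by omega) (by omega),
          hD0 _ (by omega) (by omega), Fin.ext_iff]
        simp only; omega
      have hnot : (⟨k - 1, by omega⟩ : Fin (n + 1)) ∉ D'.below := by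
        rw [mem_belowSet, hD0 _ (by omega) (by omega)]; simp
      rw [innerNormal_apply, innerNormal_apply, hins, Finset.sum_insert hnot]
      ring
    constructor
    · intro hsk
      obtain ⟨d, hd⟩ := exists_innerPair_below_eq_singleton hs0 hsn hk2 hkn hsk
      have heq : innerNormal d = innerNormal D - innerNormal D' := by
        ext w
        rw [LinearMap.sub_apply, hdiff, innerNormal_apply, hd, Finset.sum_singleton]
      obtain ⟨e, c, hc, he⟩ := hray d
      rw [heq, map_sub, hL1, hL0, sub_eq_add_neg, ← Pi.single_neg] at he
      have := pos_of_single_add_single_eq_smul_santosVector hne hc ha1 (neg_ne_zero.mpr ha0) he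
      exact ⟨by linarith [this.2], this.1⟩
    · intro hsk
      obtain ⟨d, hd⟩ := exists_innerPair_below_eq_compl_singleton hs0 hsn hk2 hkn hsk
      have heq : innerNormal d = innerNormal D' - innerNormal D := by
        ext w
        have hsum := Finset.sum_add_sum_compl ({⟨k - 1, by omega⟩} : Finset (Fin (n + 1)))
          (w : Fin (n + 1) → ℝ)
        rw [sum_vectorSpan_chainPolytope, Finset.sum_singleton] at hsum
        have := hdiff w
        rw [LinearMap.sub_apply, innerNormal_apply, hd]
        linarith
      obtain ⟨e, c, hc, he⟩ := hray d
      rw [heq, map_sub, hL1, hL0, sub_eq_add_neg, ← Pi.single_neg] at he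
      have := pos_of_single_add_single_eq_smul_santosVector hne.symm hc ha0 (neg_ne_zero.mpr ha1) he
      exact ⟨this.1, by linarith [this.2]⟩
  obtain ⟨D₀, hD₀, δ₀, a₀, ha₀, hL₀⟩ := hseg (k - 1) (by omega) (by omega)
  obtain ⟨D₁, hD₁, δ₁, a₁, ha₁, hL₁⟩ := hseg k (by omega) (by omega)
  obtain ⟨D₂, hD₂, δ₂, a₂, ha₂, hL₂⟩ := hseg (k + 1) (by omega) (by omega)
  have h1 := hstep k hk2 (by omega) D₁ D₀ hD₀ hD₁ δ₁ δ₀ a₁ a₀ ha₁ ha₀ hL₁ hL₀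
  have h2 := hstep (k + 1) (by omega) hkn D₂ D₁ hD₁ hD₂ δ₂ δ₁ a₂ a₁ ha₂ ha₁ hL₂ hL₁
  cases hk : s k <;> cases hk' : s (k + 1) <;> simp
  · linarith [(h1.1 hk).2, (h2.1 hk').1]
  · linarith [(h1.2 hk).2, (h2.2 hk').1]

end Rays

/-! ### The zigzag polygon -/

section Zigzag

/-- The alternating signs whose value at even positions is `b`. -/
def altSign (b : Bool) (k : ℕ) : Bool := if k % 2 = 0 then b else !b

theorem altSign_succ_ne (b : Bool) (k : ℕ) : altSign b (k + 1) ≠ altSign b k := by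
  unfold altSign; grind

theorem bool_eq_of_ne_of_ne {a b c : Bool} (h : a ≠ b) (h' : a ≠ c) : b = c := by
  revert a b c; decide

/-- If the signs `s` and `s'` agree at the interior positions, each chord with signs `s'`, other
than those between the two leftmost and between the two rightmost vertices, has the same
coordinates below it as some chord with signs `s`: its end points among the two leftmost or the two
rightmost vertices are exchanged with their neighbours if necessary. -/
theorem exists_below_iff_of_sign_eq {n : ℕ} {s s' : ℕ → Bool} (hn : 1 ≤ n) (hs0 : s 0 ≠ s 1)
    (hsn : s (n + 1) ≠ s (n + 2)) (hs0' : s' 0 ≠ s' 1) (hsn' : s' (n + 1) ≠ s' (n + 2))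
    (h : ∀ k, 2 ≤ k → k ≤ n → s k = s' k) {i j : ℕ} (hij : i < j) (hj : j ≤ n + 2)
    (hi : i ≠ n + 1) (hj1 : j ≠ 1) :
    ∃ i' j', i' < j' ∧ j' ≤ n + 2 ∧
      ∀ m, 1 ≤ m → m ≤ n + 1 → (Below s' i j m ↔ Below s i' j' m) := by
  obtain ⟨i', hsi, hi'⟩ : ∃ i', s' i = s i' ∧ (i = i' ∨ (i = 0 ∧ i' = 1) ∨ (i = 1 ∧ i' = 0)) := by
    by_cases hs : s' i = s i
    · exact ⟨i, hs, Or.inl rfl⟩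
    · have : i = 0 ∨ i = 1 := by
        by_contra hc; exact hs (h i (by omega) (by omega)).symm
      rcases this with rfl | rfl
      · exact ⟨1, bool_eq_of_ne_of_ne (Ne.symm hs) hs0, by simp⟩
      · exact ⟨0, bool_eq_of_ne_of_ne (Ne.symm hs) hs0.symm, by simp⟩
  obtain ⟨j', hsj, hj'⟩ : ∃ j', s' j = s j' ∧
      (j = j' ∨ (j = n + 1 ∧ j' = n + 2) ∨ (j = n + 2 ∧ j' = n + 1)) := by
    by_cases hs : s' j = s j
    · exact ⟨j, hs, Or.inl rfl⟩
    · have : j = n + 1 ∨ j = n + 2 := by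
        by_contra hc; exact hs (h j (by omega) (by omega)).symm
      rcases this with rfl | rfl
      · exact ⟨n + 2, bool_eq_of_ne_of_ne (Ne.symm hs) hsn, by simp⟩
      · exact ⟨n + 1, bool_eq_of_ne_of_ne (Ne.symm hs) hsn.symm, by simp⟩
  refine ⟨i', j', by clear h; omega, by clear h; omega, fun m hm1 hmn => ?_⟩
  unfold Below
  by_cases hm : 2 ≤ m ∧ m ≤ n
  · have := h m hm.1 hm.2
    clear h
    rcases hi' with rfl | ⟨rfl, rfl⟩ | ⟨rfl, rfl⟩ <;>
    rcases hj' with rfl | ⟨rfl, rfl⟩ | ⟨rfl, rfl⟩ <;> grind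
  · have : m = 1 ∨ m = n + 1 := by omega
    clear h
    rcases this with rfl | rfl <;>
    rcases hi' with rfl | ⟨rfl, rfl⟩ | ⟨rfl, rfl⟩ <;>
    rcases hj' with rfl | ⟨rfl, rfl⟩ | ⟨rfl, rfl⟩ <;> grind

theorem chainPolytope_subset_of_sign_eq {n : ℕ} {s s' : ℕ → Bool} (hn : 1 ≤ n) (hs0 : s 0 ≠ s 1)
    (hsn : s (n + 1) ≠ s (n + 2)) (hs0' : s' 0 ≠ s' 1) (hsn' : s' (n + 1) ≠ s' (n + 2))
    (h : ∀ k, 2 ≤ k → k ≤ n → s k = s' k) : chainPolytope n s ⊆ chainPolytope n s' := by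
  rintro x ⟨h1, h2⟩
  refine ⟨fun i j hij hj => ?_, h2⟩
  by_cases hi : i = n + 1 ∨ j = 1
  · -- the chord joins the two leftmost or the two rightmost vertices
    by_cases hs : s' (if j = 1 then 1 else n + 1) = true
    · have : belowSet n s' i j = Finset.univ := by
        ext m
        have := m.2
        simp only [mem_belowSet, Finset.mem_univ, iff_true]
        unfold Below; grind
      rw [this, h2]; simp; apply le_of_eq; ring
    · have : belowSet n s' i j = ∅ := by
        ext m
        have := m.2
        simp only [mem_belowSet, Finset.notMem_empty, iff_false]
        unfold Below; grind
      rw [this]; simp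
  · push Not at hi
    obtain ⟨i', j', hij', hj', hset⟩ := exists_below_iff_of_sign_eq hn hs0 hsn hs0' hsn' h hij hj
      hi.1 hi.2
    have : belowSet n s' i j = belowSet n s i' j' := by
      ext m
      rw [mem_belowSet, mem_belowSet, hset _ (by omega) (by omega)]
    rw [this]
    exact h1 i' j' hij' hj'

/-- The signs of the two leftmost and of the two rightmost vertices do not affect the polytope as
long as they differ in each pair. -/
theorem chainPolytope_congr {n : ℕ} {s s' : ℕ → Bool} (hn : 1 ≤ n) (hs0 : s 0 ≠ s 1)
    (hsn : s (n + 1) ≠ s (n + 2)) (hs0' : s' 0 ≠ s' 1) (hsn' : s' (n + 1) ≠ s' (n + 2))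
    (h : ∀ k, 2 ≤ k → k ≤ n → s k = s' k) : chainPolytope n s = chainPolytope n s' :=
  (chainPolytope_subset_of_sign_eq hn hs0 hsn hs0' hsn' h).antisymm
    (chainPolytope_subset_of_sign_eq hn hs0' hsn' hs0 hsn fun k h2 hk => (h k h2 hk).symm)

theorem chainPolytope_eq_alt {n : ℕ} {s : ℕ → Bool} (hn : 1 ≤ n) (hs0 : s 0 ≠ s 1)
    (hsn : s (n + 1) ≠ s (n + 2)) (h : ∀ k, 2 ≤ k → k + 1 ≤ n → s (k + 1) ≠ s k) :
    chainPolytope n s = chainPolytope n (altSign (s 2)) := by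
  refine chainPolytope_congr hn hs0 hsn (altSign_succ_ne _ 0).symm (altSign_succ_ne _ (n + 1)).symm
    fun k hk2 hkn => ?_
  induction k, hk2 using Nat.le_induction with
  | base => simp [altSign]
  | succ k hk2 ih =>
    have h1 := ih (by omega)
    have h2 := h k hk2 hkn
    have h3 := altSign_succ_ne (s 2) k
    exact bool_eq_of_ne_of_ne (h1 ▸ h2.symm) h3.symm

/-- The cyclic label of the vertex at position `t` of the zigzag polygon: the even positions form
one chain, labelled from `0` upwards, and the odd positions form the other, labelled from `n + 2`
downwards. -/
def cyclicLabel (n t : ℕ) : ℕ := if t % 2 = 0 then t / 2 else n + 2 - t / 2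

theorem cyclicLabel_le {n t : ℕ} (ht : t ≤ n + 2) : cyclicLabel n t ≤ n + 2 := by
  unfold cyclicLabel; split_ifs <;> omega

theorem exists_cyclicLabel_eq {n p : ℕ} (hp : p ≤ n + 2) : ∃ t ≤ n + 2, cyclicLabel n t = p := by
  by_cases h : 2 * p ≤ n + 2
  · exact ⟨2 * p, h, by unfold cyclicLabel; split_ifs <;> omega⟩
  · exact ⟨2 * (n + 2 - p) + 1, by omega, by unfold cyclicLabel; split_ifs <;> omega⟩

theorem altSign_eq_iff {b : Bool} {k l : ℕ} : altSign b k = altSign b l ↔ k % 2 = l % 2 := by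
  unfold altSign; cases b <;> split_ifs <;> simp <;> omega

/-- The smaller and the larger cyclic label of the end points of a chord, solved for the positions
of the end points in each of the four parity cases. -/
theorem min_max_cyclicLabel {n i j : ℕ} (hij : i < j) (hj : j ≤ n + 2) :
    ∃ p q, p < q ∧ q ≤ n + 2 ∧ min (cyclicLabel n i) (cyclicLabel n j) = p ∧
      max (cyclicLabel n i) (cyclicLabel n j) = q ∧
      ((i % 2 = 0 ∧ j % 2 = 0 ∧ i = 2 * p ∧ j = 2 * q) ∨
        (i % 2 = 1 ∧ j % 2 = 1 ∧ i + 2 * q = 2 * n + 5 ∧ j + 2 * p = 2 * n + 5) ∨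
        (i % 2 = 0 ∧ j % 2 = 1 ∧ i = 2 * p ∧ j + 2 * q = 2 * n + 5) ∨
        (i % 2 = 1 ∧ j % 2 = 0 ∧ i + 2 * q = 2 * n + 5 ∧ j = 2 * p)) := by
  have h0 : ∀ t, t % 2 = 0 → cyclicLabel n t = t / 2 := fun t ht => if_pos ht
  have h1 : ∀ t, t % 2 = 1 → cyclicLabel n t = n + 2 - t / 2 := fun t ht => if_neg (by omega)
  rcases Nat.mod_two_eq_zero_or_one i with hi | hi <;>
  rcases Nat.mod_two_eq_zero_or_one j with hj' | hj'
  · rw [h0 i hi, h0 j hj', min_eq_left (by omega), max_eq_right (by omega)]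
    exact ⟨_, _, by omega, by omega, rfl, rfl, by omega⟩
  · rw [h0 i hi, h1 j hj', min_eq_left (by omega), max_eq_right (by omega)]
    exact ⟨_, _, by omega, by omega, rfl, rfl, by omega⟩
  · rw [h1 i hi, h0 j hj', min_eq_right (by omega), max_eq_left (by omega)]
    exact ⟨_, _, by omega, by omega, rfl, rfl, by omega⟩
  · rw [h1 i hi, h1 j hj', min_eq_right (by omega), max_eq_left (by omega)]
    exact ⟨_, _, by omega, by omega, rfl, rfl, by omega⟩

/-- Crossing of chords in terms of the cyclic labels of their end points. -/
theorem chainCrosses_altSign_iff {n : ℕ} {b : Bool} {i j k l : ℕ} (hij : i < j) (hkl : k < l)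
    (hj : j ≤ n + 2) (hl : l ≤ n + 2) :
    ChainCrosses (altSign b) i j k l ↔
      ((min (cyclicLabel n i) (cyclicLabel n j) < min (cyclicLabel n k) (cyclicLabel n l) ∧
        min (cyclicLabel n k) (cyclicLabel n l) < max (cyclicLabel n i) (cyclicLabel n j) ∧
        max (cyclicLabel n i) (cyclicLabel n j) < max (cyclicLabel n k) (cyclicLabel n l)) ∨
      (min (cyclicLabel n k) (cyclicLabel n l) < min (cyclicLabel n i) (cyclicLabel n j) ∧
        min (cyclicLabel n i) (cyclicLabel n j) < max (cyclicLabel n k) (cyclicLabel n l) ∧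
        max (cyclicLabel n k) (cyclicLabel n l) < max (cyclicLabel n i) (cyclicLabel n j))) := by
  unfold ChainCrosses
  simp only [ne_eq, altSign_eq_iff]
  obtain ⟨p, q, hpq, hq, h3, h4, h⟩ := min_max_cyclicLabel hij hj
  obtain ⟨p', q', hpq', hq', h3', h4', h'⟩ := min_max_cyclicLabel hkl hl
  rw [h3, h4, h3', h4']
  clear h3 h4 h3' h4'
  rcases h with ⟨h1, h2, h3, h4⟩ | ⟨h1, h2, h3, h4⟩ | ⟨h1, h2, h3, h4⟩ | ⟨h1, h2, h3, h4⟩ <;>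
  rcases h' with ⟨h1', h2', h3', h4'⟩ | ⟨h1', h2', h3', h4'⟩ | ⟨h1', h2', h3', h4'⟩ |
    ⟨h1', h2', h3', h4'⟩ <;>
  · rw [h1, h2, h1', h2']
    clear h1 h2 h1' h2'
    simp only [zero_ne_one, one_ne_zero, not_true, not_false_iff, and_true, and_false, or_false,
      false_or, false_iff]
    omega

end Zigzag

/-! ### The cluster fan -/

section SimpleRoots

/-- The simple roots are a basis of the root space. -/
theorem exists_basis_simpleRoot (n : ℕ) :
    ∃ B : Module.Basis (Fin n) ℝ (rootSpace n), ∀ k, B k = simpleRoot k := by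
  have hli : LinearIndependent ℝ (simpleRoot : Fin n → rootSpace n) := by
    rw [Fintype.linearIndependent_iff]
    intro g hg
    have hcoord : ∀ m : Fin (n + 1), ∑ k, g k *
        ((Pi.single k.castSucc 1 - Pi.single k.succ 1 : Fin (n + 1) → ℝ) m) = 0 := by
      intro m
      have := congrFun (congrArg Subtype.val hg) m
      simpa [simpleRoot, Submodule.coe_sum, Finset.sum_apply] using this
    -- the coordinates of a combination are the successive differences of its coefficients
    have hz : ∀ t : ℕ, ∀ ht : t < n, g ⟨t, ht⟩ = 0 := by
      intro t
      induction t with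
      | zero =>
        intro ht
        have := hcoord ⟨0, by omega⟩
        rw [Finset.sum_eq_single ⟨0, ht⟩] at this
        · simpa [Pi.single_apply, Fin.ext_iff] using this
        · intro k _ hk
          have : (k : ℕ) ≠ 0 := fun h => hk (Fin.ext h)
          simp [Fin.ext_iff, this.symm]
        · simp
      | succ t ih =>
        intro ht
        have := hcoord ⟨t + 1, by omega⟩
        rw [Finset.sum_eq_single ⟨t + 1, ht⟩] at this
        · simpa [Pi.single_apply, Fin.ext_iff] using this
        · intro k _ hk
          have hk1 : (k : ℕ) ≠ t + 1 := fun h => hk (Fin.ext h)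
          by_cases hkt : (k : ℕ) = t
          · have : k = ⟨t, by omega⟩ := Fin.ext hkt
            rw [this, ih, zero_mul]
          · have h1 : ¬ (t + 1 = (k : ℕ)) := fun h => hk1 h.symm
            have h2 : ¬ (t = (k : ℕ)) := fun h => hkt h.symm
            simp [Fin.ext_iff, h1, h2]
        · simp
    exact fun k => hz k.1 k.2
  have hrank : Module.finrank ℝ (rootSpace n) = n := by
    let f : (Fin (n + 1) → ℝ) →ₗ[ℝ] ℝ := ∑ m, LinearMap.proj m
    have hf : ∀ x, f x = ∑ m, x m := fun x => by simp [f, LinearMap.sum_apply]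
    have hker : LinearMap.ker f = rootSpace n := by
      ext x
      rw [LinearMap.mem_ker, hf]; rfl
    have hsurj : LinearMap.range f = ⊤ := by
      rw [LinearMap.range_eq_top]
      intro c
      refine ⟨Pi.single 0 c, ?_⟩
      rw [hf]; simp
    have := LinearMap.finrank_range_add_finrank_ker f
    rw [hker, hsurj] at this
    simp at this
    omega
  have : Module.finrank ℝ (rootSpace n) = Fintype.card (Fin n) := by simpa using hrank
  exact ⟨basisOfLinearIndependentOfCardEqFinrank' _ hli this.symm, by simp⟩

end SimpleRoots

section ClusterFan

variable {n : ℕ} {b : Bool}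

/-- The inner pairs of the zigzag polygon join adjacent positions, except at the two ends, or
positions at distance at least `3`: positions at distance `2` are adjacent on a chain. -/
theorem InnerPair.altSign_cases (d : InnerPair n (altSign b)) :
    ((d.1.2 : ℕ) = d.1.1 + 1 ∧ 1 ≤ (d.1.1 : ℕ) ∧ (d.1.1 : ℕ) ≤ n) ∨ (d.1.1 : ℕ) + 3 ≤ d.1.2 := by
  obtain ⟨⟨i, j⟩, hij, ⟨m, hm⟩, hu⟩ := d
  obtain ⟨m', hm'⟩ : ∃ m', m' ∉ belowSet n (altSign b) i j := by
    by_contra hc; push Not at hc; exact hu (Finset.eq_univ_iff_forall.mpr hc)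
  rw [mem_belowSet] at hm hm'
  have h1 := i.2
  have h2 := j.2
  have h3 := m.2
  have h4 := m'.2
  simp only [Fin.lt_def] at hij ⊢
  generalize i.val = i at *
  generalize j.val = j at *
  generalize m.val = m at *
  generalize m'.val = m' at *
  by_contra hcon
  have : j = i + 2 ∨ (j = i + 1 ∧ (i = 0 ∨ i = n + 1)) := by omega
  have hs := altSign_succ_ne b i
  have hs' := altSign_succ_ne b (i + 1)
  unfold Below at hm hm'
  rcases this with rfl | ⟨rfl, rfl | rfl⟩
  · have hs'' := bool_eq_of_ne_of_ne hs hs'.symm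
    grind
  · grind
  · grind

theorem exists_innerPair_altSign {i j : ℕ} (hj : j ≤ n + 2)
    (h : (j = i + 1 ∧ 1 ≤ i ∧ i ≤ n) ∨ i + 3 ≤ j) :
    ∃ d : InnerPair n (altSign b), (d.1.1 : ℕ) = i ∧ (d.1.2 : ℕ) = j := by
  obtain ⟨m, hm1, hm2, hm⟩ : ∃ m, 1 ≤ m ∧ m + 1 ≤ n + 1 ∧
      (Below (altSign b) i j m ↔ ¬ Below (altSign b) i j (m + 1)) := by
    rcases h with ⟨rfl, h1, h2⟩ | h
    · refine ⟨i, h1, by omega, ?_⟩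
      have := altSign_succ_ne b i
      unfold Below; grind
    · refine ⟨i + 1, by omega, by omega, ?_⟩
      have := altSign_succ_ne b (i + 1)
      unfold Below; grind
  refine ⟨⟨(⟨i, by omega⟩, ⟨j, by omega⟩), by simp only [Fin.lt_def]; omega, ?_, ?_⟩, rfl, rfl⟩
  · by_cases hb : Below (altSign b) i j m
    · exact ⟨⟨m - 1, by omega⟩, by rw [mem_belowSet]; simpa only [Nat.sub_add_cancel hm1] using hb⟩
    · refine ⟨⟨m, by omega⟩, ?_⟩
      rw [mem_belowSet]
      by_contra hc
      exact hb (hm.mpr hc)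
  · intro hu
    have h1 := (Finset.ext_iff.mp hu ⟨m - 1, by omega⟩).mpr (Finset.mem_univ _)
    have h2 := (Finset.ext_iff.mp hu ⟨m, by omega⟩).mpr (Finset.mem_univ _)
    rw [mem_belowSet] at h1 h2
    simp only [Nat.sub_add_cancel hm1] at h1
    exact hm.mp h1 h2

/-- The diagonal with cyclically labelled end points that an inner pair of the zigzag polygon
stands for. -/
def InnerPair.toDiagonal (d : InnerPair n (altSign b)) : Diagonal n :=
  ⟨(⟨min (cyclicLabel n d.1.1) (cyclicLabel n d.1.2),
      Nat.lt_succ_of_le ((min_le_left _ _).trans (cyclicLabel_le (by omega)))⟩,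
    ⟨max (cyclicLabel n d.1.1) (cyclicLabel n d.1.2),
      Nat.lt_succ_of_le (max_le (cyclicLabel_le (by omega)) (cyclicLabel_le (by omega)))⟩), by
    have hd := d.altSign_cases
    obtain ⟨p, q, hpq, hq, h3, h4, h⟩ := min_max_cyclicLabel (n := n) d.2.1 (by omega)
    simp only [h3, h4]
    omega⟩

theorem InnerPair.crosses_toDiagonal (d e : InnerPair n (altSign b)) :
    _root_.Crosses d.toDiagonal e.toDiagonal ↔ d.Crosses e :=
  (chainCrosses_altSign_iff d.2.1 e.2.1 (by omega) (by omega)).symm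

theorem InnerPair.toDiagonal_surjective :
    Function.Surjective (InnerPair.toDiagonal : InnerPair n (altSign b) → Diagonal n) := by
  rintro ⟨⟨p, q⟩, hpq, hpq'⟩
  simp only at hpq hpq'
  obtain ⟨t, ht, hpt⟩ := exists_cyclicLabel_eq (n := n) (p := p) (by omega)
  obtain ⟨u, hu, hqu⟩ := exists_cyclicLabel_eq (n := n) (p := q) (by omega)
  rcases lt_trichotomy t u with h | rfl | h
  · obtain ⟨d, hd1, hd2⟩ := exists_innerPair_altSign (n := n) (b := b) (i := t) (j := u) hu (by
      unfold cyclicLabel at hpt hqu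
      split_ifs at hpt hqu <;> omega)
    refine ⟨d, Subtype.ext (Prod.ext (Fin.ext ?_) (Fin.ext ?_))⟩ <;>
    simp only [InnerPair.toDiagonal, hd1, hd2, hpt, hqu] <;> omega
  · omega
  · obtain ⟨d, hd1, hd2⟩ := exists_innerPair_altSign (n := n) (b := b) (i := u) (j := t) ht (by
      unfold cyclicLabel at hpt hqu
      split_ifs at hpt hqu <;> omega)
    refine ⟨d, Subtype.ext (Prod.ext (Fin.ext ?_) (Fin.ext ?_))⟩ <;>
    simp only [InnerPair.toDiagonal, hd1, hd2, hpt, hqu] <;> omega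

/-- The snake consists of the diagonals between adjacent positions of the zigzag. -/
theorem InnerPair.toDiagonal_eq_snakeDiagonal_iff (d : InnerPair n (altSign b)) (k : Fin n) :
    d.toDiagonal = snakeDiagonal k ↔ (d.1.1 : ℕ) = k + 1 ∧ (d.1.2 : ℕ) = k + 2 := by
  obtain ⟨p, q, hpq, hq, h3, h4, h5⟩ := min_max_cyclicLabel (n := n) d.2.1 (by omega)
  have hd := d.2.1
  rw [Fin.lt_def] at hd
  have hk := k.2
  simp only [InnerPair.toDiagonal, snakeDiagonal, Subtype.mk.injEq, Prod.mk.injEq, Fin.mk.injEq, h3,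
    h4]
  omega

/-- A long pair crosses the adjacent pairs strictly inside it, because the end points of these lie
on different chains. -/
theorem InnerPair.crosses_snakeDiagonal_iff (d : InnerPair n (altSign b)) (k : Fin n) :
    _root_.Crosses d.toDiagonal (snakeDiagonal k) ↔
      (d.1.1 : ℕ) ≤ k ∧ (k : ℕ) + 3 ≤ d.1.2 := by
  obtain ⟨e, he1, he2⟩ := exists_innerPair_altSign (n := n) (b := b) (i := k + 1) (j := k + 2)
    (by omega) (Or.inl ⟨rfl, by omega, by omega⟩)
  rw [← (e.toDiagonal_eq_snakeDiagonal_iff k).mpr ⟨he1, he2⟩, d.crosses_toDiagonal]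
  have := altSign_succ_ne b (k + 1)
  unfold InnerPair.Crosses ChainCrosses
  rw [he1, he2]
  simp only [this.symm, ne_eq, not_false_iff, and_true]
  omega

/-- The almost positive root of an inner pair of the zigzag polygon. -/
noncomputable def pairRoot (d : InnerPair n (altSign b)) : rootSpace n :=
  if (d.1.2 : ℕ) = d.1.1 + 1 then -∑ k : Fin n with k.val + 1 = d.1.1.val, simpleRoot k
  else ∑ k : Fin n with d.1.1.val ≤ k.val ∧ k.val + 3 ≤ d.1.2.val, simpleRoot k

theorem isRootOfDiagonal_toDiagonal_iff (d : InnerPair n (altSign b)) (r : rootSpace n) :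
    IsRootOfDiagonal r d.toDiagonal ↔ r = pairRoot d := by
  have hsing : ∀ k : Fin n, (Finset.univ.filter fun l : Fin n => l.val + 1 = k.val + 1) = {k} := by
    intro k; ext l; simp [Fin.ext_iff]
  constructor
  · rintro (⟨k, rfl, hk⟩ | ⟨k, l, hkl, rfl, h⟩)
    · rw [d.toDiagonal_eq_snakeDiagonal_iff] at hk
      rw [pairRoot, if_pos (by omega), hk.1, hsing, Finset.sum_singleton]
    · simp only [d.crosses_snakeDiagonal_iff] at h
      have hk := (h k).mpr (Finset.mem_Icc.mpr ⟨le_rfl, hkl⟩)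
      rw [pairRoot, if_neg (by omega)]
      refine Finset.sum_congr ?_ fun _ _ => rfl
      ext m
      rw [← h m]; simp
  · rintro rfl
    rcases d.altSign_cases with ⟨h, h1, h2⟩ | h
    · refine Or.inl ⟨⟨d.1.1 - 1, by omega⟩, ?_, ?_⟩
      · rw [pairRoot, if_pos h]
        have := hsing ⟨d.1.1 - 1, by omega⟩
        simp only [Nat.sub_add_cancel h1] at this
        rw [this, Finset.sum_singleton]
      · rw [d.toDiagonal_eq_snakeDiagonal_iff]
        simp only; omega
    · have hj := d.1.2.2
      refine Or.inr ⟨⟨d.1.1, by omega⟩, ⟨d.1.2 - 3, by omega⟩, ?_, ?_, fun k => ?_⟩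
      · rw [Fin.le_def]; simp only; omega
      · rw [pairRoot, if_neg (by omega)]
        refine Finset.sum_congr ?_ fun _ _ => rfl
        ext m
        simp only [Finset.mem_filter, Finset.mem_univ, true_and, Finset.mem_Icc, Fin.le_def]
        omega
      · rw [d.crosses_snakeDiagonal_iff]
        simp only [Finset.mem_Icc, Fin.le_def]
        omega

theorem clusterFan_eq_compatibleFan (n : ℕ) (b : Bool) :
    clusterFan n = compatibleFan InnerPair.Crosses (pairRoot : InnerPair n (altSign b) → _) := by
  ext C
  constructor
  · rintro ⟨D, hD, rfl⟩
    refine ⟨InnerPair.toDiagonal ⁻¹' D, fun d hd e he => ?_, ?_⟩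
    · rw [← d.crosses_toDiagonal]; exact hD _ hd _ he
    · congr 2
      ext r
      constructor
      · rintro ⟨d', hd', hr⟩
        obtain ⟨d, rfl⟩ := InnerPair.toDiagonal_surjective (b := b) d'
        exact ⟨d, hd', ((isRootOfDiagonal_toDiagonal_iff d r).mp hr).symm⟩
      · rintro ⟨d, hd, rfl⟩
        exact ⟨_, hd, (isRootOfDiagonal_toDiagonal_iff d _).mpr rfl⟩
  · rintro ⟨D, hD, rfl⟩
    refine ⟨InnerPair.toDiagonal '' D, ?_, ?_⟩
    · rintro _ ⟨d, hd, rfl⟩ _ ⟨e, he, rfl⟩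
      rw [d.crosses_toDiagonal]; exact hD d hd e he
    · congr 2
      ext r
      constructor
      · rintro ⟨d, hd, rfl⟩
        exact ⟨_, ⟨d, hd, rfl⟩, (isRootOfDiagonal_toDiagonal_iff d _).mpr rfl⟩
      · rintro ⟨_, ⟨d, hd, rfl⟩, hr⟩
        exact ⟨d, hd, ((isRootOfDiagonal_toDiagonal_iff d r).mp hr).symm⟩

end ClusterFan

/-! ### Realizations of the cluster fan -/

section Realizations

variable {n : ℕ} {b : Bool}

open Classical in
/-- The values of the normal of an inner pair of the zigzag polygon on the simple roots are the
coefficients of the corresponding almost positive root, up to signs that alternate along the simple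
roots and do not depend on the pair. -/
theorem innerNormal_altSign_apply (d : InnerPair n (altSign b)) (k : Fin n) :
    innerNormal d (rootVector k.castSucc k.succ) * (if altSign b (k + 1) = true then 1 else -1) =
      if d.1.2.val = d.1.1.val + 1 then (if k.val + 1 = d.1.1.val then -1 else 0)
      else if d.1.1.val ≤ k.val ∧ k.val + 3 ≤ d.1.2.val then 1 else 0 := by
  have hs := altSign_succ_ne b (k + 1)
  have hd := d.altSign_cases
  rw [innerNormal_rootVector]
  simp only [Fin.val_castSucc, Fin.val_succ]
  obtain ⟨k, _⟩ := k
  dsimp only at hs ⊢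
  generalize d.1.1.val = i at *
  generalize d.1.2.val = j at *
  rcases hd with ⟨rfl, h1, h2⟩ | hd
  · rw [if_pos rfl]
    by_cases hk : k + 1 = i
    · subst hk
      have e1 : Below (altSign b) (k + 1) (k + 1 + 1) (k + 1) ↔ altSign b (k + 1) = true := by
        unfold Below; grind
      have e2 : Below (altSign b) (k + 1) (k + 1 + 1) (k + 1 + 1) ↔ ¬ altSign b (k + 1) = true := by
        unfold Below; grind
      simp only [e1, e2]
      split_ifs <;> norm_num
    · have e : Below (altSign b) i (i + 1) (k + 1 + 1) ↔ Below (altSign b) i (i + 1) (k + 1) := by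
        unfold Below; grind
      simp only [e, if_neg hk, sub_self, zero_mul]
  · rw [if_neg (show ¬ j = i + 1 by omega)]
    by_cases hk : i ≤ k ∧ k + 3 ≤ j
    · have e1 : Below (altSign b) i j (k + 1) ↔ ¬ altSign b (k + 1) = true := by
        unfold Below; grind
      have e2 : Below (altSign b) i j (k + 1 + 1) ↔ altSign b (k + 1) = true := by
        unfold Below; grind
      simp only [e1, e2, if_pos hk]
      split_ifs <;> norm_num
    · have e : Below (altSign b) i j (k + 1 + 1) ↔ Below (altSign b) i j (k + 1) := by
        unfold Below; grind
      simp only [e, if_neg hk, sub_self, zero_mul]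

/-- The normal fan of the polytope of the zigzag polygon is the cluster fan: the dual basis of the
simple roots goes to the simple roots with alternating signs. -/
theorem normalFan_altSign_linearlyIsomorphic (n : ℕ) (b : Bool) :
    LinearlyIsomorphic (normalFan (chainPolytope n (altSign b))) (clusterFan n) := by
  classical
  rw [normalFan_chainPolytope (altSign_succ_ne b 0).symm (altSign_succ_ne b (n + 1)).symm,
    clusterFan_eq_compatibleFan n b]
  obtain ⟨B, hB⟩ := exists_basis_simpleRoot n
  let B' := B.map (LinearEquiv.ofEq _ _ (vectorSpan_chainPolytope (n := n) (s := altSign b)).symm)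
  have hB' : ∀ k, B' k = rootVector k.castSucc k.succ := by
    intro k
    ext1
    simp [B', hB, rootVector, simpleRoot]
  let ε : Fin n → ℝˣ := fun k => if altSign b (k + 1) = true then 1 else -1
  refine linearlyIsomorphic_compatibleFan
    (B'.dualBasis.equivFun.trans (B.unitsSMul ε).equivFun.symm) fun d => ?_
  rw [LinearEquiv.trans_apply, Module.Basis.equivFun_symm_apply]
  have hterm : ∀ k, B'.dualBasis.equivFun (innerNormal d) k • (B.unitsSMul ε) k =
      (if d.1.2.val = d.1.1.val + 1 then (if k.val + 1 = d.1.1.val then (-1 : ℝ) else 0)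
      else if d.1.1.val ≤ k.val ∧ k.val + 3 ≤ d.1.2.val then 1 else 0) • simpleRoot k := by
    intro k
    rw [Module.Basis.dualBasis_equivFun, hB', Module.Basis.unitsSMul_apply, hB, Units.smul_def,
      smul_smul, ← innerNormal_altSign_apply]
    simp only [ε]
    split_ifs
    · simp
    · simp only [Units.val_neg, Units.val_one, mul_neg, mul_one]
  rw [Finset.sum_congr rfl fun k _ => hterm k, pairRoot]
  split_ifs with h
  · rw [← Finset.sum_neg_distrib, Finset.sum_filter]
    refine Finset.sum_congr rfl fun k _ => ?_
    split_ifs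
    exacts [neg_one_smul ℝ (simpleRoot k), zero_smul ℝ (simpleRoot k)]
  · rw [Finset.sum_filter]
    exact Finset.sum_congr rfl fun k _ => by rw [ite_smul, one_smul, zero_smul]

theorem snakeDiagonal_injective : Function.Injective (snakeDiagonal : Fin n → Diagonal n) := by
  intro k l h
  simp only [snakeDiagonal, Subtype.mk.injEq, Prod.mk.injEq, Fin.mk.injEq] at h
  exact Fin.ext (by omega)

/-- The snake is a triangulation: a diagonal outside it joins positions at distance at least `3` of
the zigzag, so it crosses a diagonal of the snake. -/
theorem isTriangulation_snake :
    IsTriangulation (Set.range (snakeDiagonal : Fin n → Diagonal n)) := by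
  constructor
  · rintro _ ⟨k, rfl⟩ _ ⟨l, rfl⟩
    obtain ⟨d, hd⟩ := InnerPair.toDiagonal_surjective (b := true) (snakeDiagonal k)
    have h := (d.toDiagonal_eq_snakeDiagonal_iff k).mp hd
    rw [← hd, d.crosses_snakeDiagonal_iff]
    omega
  · intro D hD hsub d hd
    obtain ⟨e, rfl⟩ := InnerPair.toDiagonal_surjective (b := true) d
    rcases e.altSign_cases with ⟨h, h1, h2⟩ | h
    · exact ⟨⟨e.1.1 - 1, by omega⟩, ((e.toDiagonal_eq_snakeDiagonal_iff _).mpr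
        ⟨by simp only; omega, by simp only; omega⟩).symm⟩
    · have hj := e.1.2.2
      refine absurd ((e.crosses_snakeDiagonal_iff ⟨e.1.1, by omega⟩).mpr ⟨le_rfl, h⟩) ?_
      exact hD _ hd _ (hsub ⟨_, rfl⟩)

/-- The cluster fan is the Santos fan of the snake, whose basis vectors correspond to the simple
roots. -/
theorem clusterFan_linearlyIsomorphic_santosFan (n : ℕ) :
    LinearlyIsomorphic (clusterFan n)
      (santosFan (Set.range (snakeDiagonal : Fin n → Diagonal n))) := by
  classical
  have hsantos : santosFan (Set.range (snakeDiagonal : Fin n → Diagonal n)) =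
      compatibleFan InnerPair.Crosses
        (santosVector (Set.range snakeDiagonal) ∘
          (InnerPair.toDiagonal : InnerPair n (altSign true) → Diagonal n)) :=
    compatibleFan_comp (cr' := Crosses) _ InnerPair.toDiagonal_surjective
      InnerPair.crosses_toDiagonal
  rw [hsantos, clusterFan_eq_compatibleFan n true]
  obtain ⟨B, hB⟩ := exists_basis_simpleRoot n
  let e : Fin n ≃ Set.range (snakeDiagonal : Fin n → Diagonal n) :=
    Equiv.ofInjective _ snakeDiagonal_injective
  let M := B.equiv (Pi.basisFun ℝ (Set.range (snakeDiagonal : Fin n → Diagonal n))) e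
  have hM : ∀ k, M (simpleRoot k) = Pi.single (e k) 1 := by
    intro k
    rw [← hB, Module.Basis.equiv_apply, Pi.basisFun_apply]
  refine linearlyIsomorphic_compatibleFan M fun d => ?_
  rw [Function.comp_apply, pairRoot]
  rcases d.altSign_cases with ⟨h, h1, h2⟩ | h
  · have hk : d.toDiagonal = snakeDiagonal ⟨d.1.1 - 1, by omega⟩ :=
      (d.toDiagonal_eq_snakeDiagonal_iff _).mpr ⟨by simp only; omega, by simp only; omega⟩
    have hsing : (Finset.univ.filter fun k : Fin n => k.val + 1 = d.1.1.val) =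
        {⟨d.1.1 - 1, by omega⟩} := by
      ext k; simp only [Finset.mem_filter, Finset.mem_univ, true_and, Finset.mem_singleton,
        Fin.ext_iff]; omega
    rw [if_pos h, hsing, Finset.sum_singleton, map_neg, hM, hk,
      santosVector_of_mem (Set.mem_range_self _)]
    rfl
  · have hT : d.toDiagonal ∉ Set.range (snakeDiagonal : Fin n → Diagonal n) := by
      rintro ⟨k, hk⟩
      have := (d.toDiagonal_eq_snakeDiagonal_iff k).mp hk.symm
      omega
    rw [if_neg (by omega), map_sum, Finset.sum_filter, santosVector, dif_neg hT]
    -- the sum over the snake in `santosVector` uses another `Fintype` instance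
    refine Eq.trans ?_ <| (Equiv.sum_comp e fun δ => if Crosses d.toDiagonal δ.1 then
      (Pi.single δ 1 : Set.range (snakeDiagonal : Fin n → Diagonal n) → ℝ) else 0) |>.trans ?_
    swap
    · exact Finset.sum_congr (by ext; simp) fun _ _ => rfl
    refine Finset.sum_congr rfl fun k _ => ?_
    rw [hM]
    have hiff : Crosses d.toDiagonal (e k).1 ↔ d.1.1.val ≤ k.val ∧ k.val + 3 ≤ d.1.2.val :=
      d.crosses_snakeDiagonal_iff k
    by_cases hc : d.1.1.val ≤ k.val ∧ k.val + 3 ≤ d.1.2.val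
    · rw [if_pos hc, if_pos (hiff.mpr hc)]
    · rw [if_neg hc, if_neg (fun h => hc (hiff.mp h))]

/-- Forgetting the last coordinate, which is determined by the others, turns the polytope of the
zigzag polygon into a full-dimensional one. -/
theorem exists_isCFZAssociahedron (n : ℕ) : ∃ Q : Set (Fin n → ℝ), IsCFZAssociahedron n Q := by
  let f : (Fin (n + 1) → ℝ) →ₗ[ℝ] (Fin n → ℝ) := LinearMap.funLeft ℝ ℝ Fin.castSucc
  refine ⟨f '' chainPolytope n (altSign true), ?_, ?_⟩
  · obtain ⟨t, ht, hP⟩ := isPolytope_chainPolytope (altSign_succ_ne true 0).symm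
      (altSign_succ_ne true (n + 1)).symm
    exact ⟨f '' t, ht.image f, by rw [hP]; exact f.image_convexHull t⟩
  · refine (normalFan_image_linearlyIsomorphic f fun w hw hfw => ?_).trans
      (normalFan_altSign_linearlyIsomorphic n true)
    rw [vectorSpan_chainPolytope] at hw
    have hw0 : ∀ k : Fin n, w k.castSucc = 0 := fun k => congrFun hfw k
    have hsum : ∑ m, w m = 0 := hw
    rw [Fin.sum_univ_castSucc, Finset.sum_eq_zero fun k _ => hw0 k, zero_add] at hsum
    ext m
    refine Fin.lastCases ?_ (fun k => ?_) m
    · exact hsum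
    · exact hw0 k

theorem normalFan_hohlwegLange_linearlyIsomorphic (hn : 1 ≤ n) {σ : Fin (n - 1) → Bool}
    (h : ∀ k, 2 ≤ k → k + 1 ≤ n → hlSign n σ (k + 1) ≠ hlSign n σ k) :
    LinearlyIsomorphic (normalFan (hohlwegLange n σ)) (clusterFan n) := by
  rw [hohlwegLange_eq_chainPolytope, chainPolytope_eq_alt hn (hlSign_left σ) (hlSign_right σ) h]
  exact normalFan_altSign_linearlyIsomorphic n _

end Realizations

/-- The family of Chapoton–Fomin–Zelevinsky associahedra of dimension `n` is nonempty, and a polytope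
is normally isomorphic both to a Hohlweg–Lange and to a Santos associahedron of dimension `n` exactly
when it is normally isomorphic to the Chapoton–Fomin–Zelevinsky associahedron. -/
theorem mainTheorem1 (n : ℕ) (hn : 1 ≤ n) :
    (∃ Q : Set (Fin n → ℝ), IsCFZAssociahedron n Q) ∧
    ∀ {E : Type*} [AddCommGroup E] [Module ℝ E] (P : Set E), IsPolytope P →
      (((∃ σ : Fin (n - 1) → Bool, NormallyIsomorphic P (hohlwegLange n σ)) ∧
        (∃ T : Set (Diagonal n), IsTriangulation T ∧
          ∃ Q : Set (Fin n → ℝ), IsSantosAssociahedron T Q ∧ NormallyIsomorphic P Q)) ↔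
      ∃ Q : Set (Fin n → ℝ), IsCFZAssociahedron n Q ∧ NormallyIsomorphic P Q) := by
  refine ⟨exists_isCFZAssociahedron n, fun P _ => ⟨?_, ?_⟩⟩
  · rintro ⟨⟨σ, hσ⟩, T, -, Q, hQ, hPQ⟩
    have hiso : LinearlyIsomorphic (normalFan (hohlwegLange n σ)) (santosFan T) :=
      (LinearlyIsomorphic.symm hσ).trans (LinearlyIsomorphic.trans hPQ hQ.2)
    rw [hohlwegLange_eq_chainPolytope] at hiso
    obtain ⟨R, hR⟩ := exists_isCFZAssociahedron n
    have hcluster := normalFan_hohlwegLange_linearlyIsomorphic hn (σ := σ) fun k hk2 hkn =>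
      sign_alternates (hlSign_left σ) (hlSign_right σ) hiso hk2 hkn
    exact ⟨R, hR, LinearlyIsomorphic.trans hσ (hcluster.trans hR.2.symm)⟩
  · rintro ⟨Q, hQ, hPQ⟩
    refine ⟨⟨fun k => altSign true (k + 2), ?_⟩, _, isTriangulation_snake, Q,
      ⟨hQ.1, hQ.2.trans (clusterFan_linearlyIsomorphic_santosFan n)⟩, hPQ⟩
    refine LinearlyIsomorphic.trans hPQ (hQ.2.trans (LinearlyIsomorphic.symm ?_))
    refine normalFan_hohlwegLange_linearlyIsomorphic hn fun k hk2 hkn => ?_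
    rw [hlSign_interior (by omega) hkn, hlSign_interior hk2 (by omega)]
    simp only [Nat.sub_add_cancel hk2, Nat.sub_add_cancel (show 2 ≤ k + 1 by omega)]
    exact altSign_succ_ne true k
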